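/- An access point (AP) serves clients $1,\dots,N$ in slotted time. Slots are grouped into periods $[kT,(k+1)T)$ with $T\ge 1$. At the beginning of a period at most one packet per client arrives; $S_k$ is the set of clients with an arrival in period $k$. The channel state $c_k$, constant within a period, takes values in a finite set. The channel state and the arrivals (the latter through a finite-state process that determines $S_k$) are stationary irreducible Markov chains, jointly Markov and stationary, and $c_k$ and $S_k$ are independent in each period. In channel state $c$ an error-free transmission to client $n$ takes $s_{c,n}\ge 1$ consecutive slots. The packet of client $n$ is discarded unless its transmission is completed within the first $\tau_n\le T$ slots of the period. A scheduling policy decides in every slot, possibly at random, from the whole past history and the current state, which client to transmit to, or to stay idle. Let $d_n(t)$ be the number of packets delivered to $n$ up to slot $t$. Requirements $[q_n]$, $q_n>0$, are fulfilled by a policy if for every $\varepsilon>0$, $\Pr\{d_n(t)/(t/T)>q_n-\varepsilon\ \forall n\}\to1$ as $t\to\infty$; they are strictly feasible if for some $\alpha\in(0,1)$ some policy fulfills $[q_n/\alpha]$. A policy (which may use $[q_n]$) is feasibility optimal if it fulfills all strictly feasible $[q_n]$. Let $r_n(k)=q_nk-d_n(kT)$ be the delivery debt, and $\mu_n(k)\in\{0,1\}$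 the number of packets delivered to $n$ in period $k$. A policy maximizes the payoff function if in every period $k$ and every state $(c,S,\rho)$ that occurs with positive probability, no policy has a larger value of $\sum_n E\{r_n(k)^+\mu_n(k)\mid c_k=c,S_k=S,[r_m(k)]=\rho\}$. A set $U$ of clients is deadline-feasible (in channel state $c$) if it has an ordering $m_1,\dots,m_l$ with $\sum_{j\le i}s_{c,m_j}\le\tau_{m_i}$ for all $i\le l$. Then: 1. If $U$ is deadline-feasible, every earliest-deadline-first ordering of $U$ satisfies these inequalities. 2. Consider any policy that in every period chooses a deadline-feasible subset $U$ of $S_k$ for which $\sum_{n\in U}r_n(k)$ is maximal among all deadline-feasible subsets of $S_k$, and transmits the packets of $U$ back to back in an order satisfying the inequalities (for example, earliest deadline first). It maximizes the payoff function, and it is feasibility optimal. 3. Sort the clients so that $\tau_1\le\dots\le\tau_N$. Fix a horizon $H\ge\max_n\tau_n$ (for example $H=T$ or $H=\max_n\tau_n$), a channel state $c$, a set $S$ of arrivals, and debts $r_n=q_nk-d_n$. For $0\le n\le N$, $0\le t\le H$ let $M[n,t]$ be the largest total debt of a set of clients from $S\cap\{1,\dots,n\}$ that is deadline-feasible with deadlines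 $\min(\tau_i,t)$. Then for $1\le n\le N$, $1\le t\le H$, $$M[n,t]=\begin{cases}M[n,t-1]&\text{if }t>\tau_n,\\ \max\{M[n-1,t],\,r_n+M[n-1,t-s_{c,n}]\}&\text{if }t\le\tau_n,\ n\in S,\ s_{c,n}\le t,\\ M[n-1,t]&\text{otherwise.}\end{cases}$$ The modified knapsack algorithm, which computes the debts, sorts the clients, sets $M[0,t]=M[n,0]=0$ and $S'[0,t]=S'[n,0]=\emptyset$, and then for $n=1,\dots,N$ and $t=1,\dots,H$ sets $(M,S')[n,t]$ to $(M,S')[n,t-1]$ if $t>\tau_n$; to $(r_n+M[n-1,t-s_{c,n}],\ S'[n-1,t-s_{c,n}]\cup\{n\})$ if $t\le\tau_n$, $n\in S$, $s_{c,n}\le t$ and $r_n+M[n-1,t-s_{c,n}]>M[n-1,t]$; and to $(M,S')[n-1,t]$ otherwise, computes all these values $M[n,t]$. Its output $S'[N,H]$, listed earliest deadline first, is a deadline-feasible subset of $S$ with maximal total debt $M[N,H]$. For $N,H\ge1$ it takes at most $C\,N\,H$ steps on a unit-cost machine with real arithmetic and linked lists, with an absolute constant $C$. 4. The Modified Knapsack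 Policy, which runs this algorithm at the beginning of each period and transmits the packets of $S'[N,H]$ back to back, earliest deadline first, is therefore a policy as in 2; it maximizes the payoff function and is feasibility optimal. -/

import Mathlib

/-! ### Deadline-feasible sets of clients (service times `s`, deadlines `τ`, in slots) -/

/-- Transmitting back to back in the order of the list, every packet meets its deadline. -/
def OnTime {N : ℕ} (s τ : Fin N → ℕ) (l : List (Fin N)) : Prop :=
  ∀ l₁ n l₂, l = l₁ ++ n :: l₂ → (l₁.map s).sum + s n ≤ τ n

/-- The list `l` is an ordering of the set `U`. -/
def IsOrderingOf {N : ℕ} (U : Finset (Fin N)) (l : List (Fin N)) : Prop :=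
  l.Nodup ∧ ∀ n, n ∈ l ↔ n ∈ U

/-- Some ordering of `U` lets all packets of `U` meet their deadlines. -/
def DeadlineFeasible {N : ℕ} (s τ : Fin N → ℕ) (U : Finset (Fin N)) : Prop :=
  ∃ l, IsOrderingOf U l ∧ OnTime s τ l

/-- `l` lists `U` earliest deadline first (ties in any order). -/
def IsEDFOrder {N : ℕ} (τ : Fin N → ℕ) (U : Finset (Fin N)) (l : List (Fin N)) : Prop :=
  IsOrderingOf U l ∧ l.Pairwise (fun a b => τ a ≤ τ b)

/-- `U` is a deadline-feasible subset of `S` with the largest total debt. -/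
def IsMaxDebtSet {N : ℕ} (s τ : Fin N → ℕ) (S : Finset (Fin N)) (r : Fin N → ℝ)
    (U : Finset (Fin N)) : Prop :=
  (U ⊆ S ∧ DeadlineFeasible s τ U) ∧
    ∀ V, V ⊆ S → DeadlineFeasible s τ V → ∑ n ∈ V, r n ≤ ∑ n ∈ U, r n

/-- The client served in slot `t` when the packets of the list are transmitted back to back from
slot `0` on. -/
def backToBack {N : ℕ} (s : Fin N → ℕ) : List (Fin N) → ℕ → Option (Fin N)
  | [], _ => none
  | n :: l, t => if t < s n then some n else backToBack s l (t - s n)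

/-! ### The wireless system -/

/-- All states communicate. -/
def IrreducibleChain {α : Type*} (P : α → PMF α) : Prop :=
  ∀ x y, Relation.ReflTransGen (fun a b => P a b ≠ 0) x y

/-- The system with rate adaptation: `N` clients, periods of `T` slots.

`𝒞` is the set of channel states and `𝒜` the state space of the arrival process; in arrival state
`a` packets arrive for exactly the clients in `arr a` (so Markov-modulated arrivals are covered).
The pair of both states evolves as a stationary Markov chain, started from `init`, for which
channel and arrivals are each an irreducible Markov chain and are independent of each other in a
period (by `stationary`, in every period). Two independent stationary irreducible chains are the
main example. -/
structure WirelessSystem (N T : ℕ) (𝒞 : Type*) (𝒜 : Type*) where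
  T_pos : 0 < T
  /-- delay bounds -/
  τ : Fin N → ℕ
  τ_le : ∀ n, τ n ≤ T
  /-- `s c n` slots are needed for an error-free transmission to `n` in channel state `c` -/
  s : 𝒞 → Fin N → ℕ
  s_pos : ∀ c n, 1 ≤ s c n
  arr : 𝒜 → Finset (Fin N)
  init : PMF (𝒞 × 𝒜)
  trans : 𝒞 × 𝒜 → PMF (𝒞 × 𝒜)
  stationary : init.bind trans = init
  channel : 𝒞 → PMF 𝒞
  channel_markov : ∀ e, (trans e).map Prod.fst = channel e.1
  channel_irreducible : IrreducibleChain channel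
  arrival : 𝒜 → PMF 𝒜
  arrival_markov : ∀ e, (trans e).map Prod.snd = arrival e.2
  arrival_irreducible : IrreducibleChain arrival
  indep : ∀ c S, init.toOuterMeasure {e | e.1 = c ∧ arr e.2 = S} =
    init.map (fun e => e.1) c * init.map (fun e => arr e.2) S

/-- What the AP does in the slots of one period: in every slot it transmits the packet of some
client or stays idle. -/
abbrev SlotPlan (N T : ℕ) : Type := Fin T → Option (Fin N)

/-- Record of one period: channel and arrival state, and the actions of the AP. -/
abbrev PeriodRecord (N T : ℕ) (𝒞 : Type*) (𝒜 : Type*) := (𝒞 × 𝒜) × SlotPlan N T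

/-- A history-dependent randomized scheduling policy. At period `k` it knows the records of the
periods before `k` and the channel and arrival states of period `k`, and chooses its actions in
period `k` at random. (Transmissions are error-free, so nothing random is revealed to the AP within
a period, and choosing slot by slot is the same as choosing all actions of the period.) -/
abbrev Policy (N T : ℕ) (𝒞 : Type*) (𝒜 : Type*) :=
  (k : ℕ) → (Fin k → PeriodRecord N T 𝒞 𝒜) → 𝒞 × 𝒜 → PMF (SlotPlan N T)

namespace WirelessSystem

variable {N T : ℕ} {𝒞 : Type*} {𝒜 : Type*} (m : WirelessSystem N T 𝒞 𝒜)

/-- Law of the state of period `k`, given the history. -/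
noncomputable def stateLaw : (k : ℕ) → (Fin k → PeriodRecord N T 𝒞 𝒜) → PMF (𝒞 × 𝒜)
  | 0, _ => m.init
  | k + 1, h => m.trans (h (Fin.last k)).1

/-- Law of the records of the first `k` periods under the policy `η`. -/
noncomputable def law (η : Policy N T 𝒞 𝒜) : (k : ℕ) → PMF (Fin k → PeriodRecord N T 𝒞 𝒜)
  | 0 => PMF.pure Fin.elim0
  | k + 1 => (law η k).bind fun h => (m.stateLaw k h).bind fun e =>
      (η k h e).map fun σ => Fin.snoc (α := fun _ => PeriodRecord N T 𝒞 𝒜) h (e, σ)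

/-- The packet of client `n` in the recorded period is delivered within the first `u` slots of the
period: it arrived, and `s c n` consecutive slots, before slot `u` and before the deadline, were
spent on it. -/
def DeliveredBy (x : PeriodRecord N T 𝒞 𝒜) (n : Fin N) (u : ℕ) : Prop :=
  n ∈ m.arr x.1.2 ∧ ∃ a, a + m.s x.1.1 n ≤ min u (m.τ n) ∧
    ∀ t : Fin T, a ≤ t → (t : ℕ) < a + m.s x.1.1 n → x.2 t = some n

open Classical in
/-- `d_n(t)`: the number of packets delivered to `n` up to time slot `t` (in the recorded
periods). -/
noncomputable def deliveries {k : ℕ} (h : Fin k → PeriodRecord N T 𝒞 𝒜) (n : Fin N) (t : ℕ) : ℕ :=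
  (Finset.univ.filter fun j : Fin k => m.DeliveredBy (h j) n (t - (j : ℕ) * T)).card

/-- The delivery debt `q_n k - d_n(kT)`. -/
noncomputable def debt (q : Fin N → ℝ) {k : ℕ} (h : Fin k → PeriodRecord N T 𝒞 𝒜) (n : Fin N) : ℝ :=
  q n * k - m.deliveries h n (k * T)

/-- The clients with timely-throughput requirements `q` are fulfilled under `η`. (Up to slot `t`,
exactly `t / T + 1` periods have begun.) -/
def Fulfilled (η : Policy N T 𝒞 𝒜) (q : Fin N → ℝ) : Prop :=
  ∀ ε : ℝ, 0 < ε → Filter.Tendsto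
    (fun t : ℕ => (m.law η (t / T + 1)).toOuterMeasure
      {h | ∀ n, q n - ε < (m.deliveries h n t : ℝ) / ((t : ℝ) / (T : ℝ))})
    Filter.atTop (nhds 1)

def Feasible (q : Fin N → ℝ) : Prop := ∃ η : Policy N T 𝒞 𝒜, m.Fulfilled η q

def StrictlyFeasible (q : Fin N → ℝ) : Prop :=
  ∃ α : ℝ, 0 < α ∧ α < 1 ∧ m.Feasible (fun n => q n / α)

/-- The policy, which may use the requirements `q`, fulfills every strictly feasible set of
clients. -/
def FeasibilityOptimal (η : (Fin N → ℝ) → Policy N T 𝒞 𝒜) : Prop :=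
  ∀ q : Fin N → ℝ, (∀ n, 0 < q n) → m.StrictlyFeasible q → m.Fulfilled (η q) q

/-- The records of the first `k + 1` periods for which `c_k = c`, `S_k = S`, and the debts at the
beginning of period `k` are `ρ`. -/
def stateEvent (q : Fin N → ℝ) (k : ℕ) (c : 𝒞) (S : Finset (Fin N)) (ρ : Fin N → ℝ) :
    Set (Fin (k + 1) → PeriodRecord N T 𝒞 𝒜) :=
  {h | (h (Fin.last k)).1.1 = c ∧ m.arr (h (Fin.last k)).1.2 = S ∧
    m.debt q (fun j : Fin k => h j.castSucc) = ρ}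

/-- The payoff `∑ n, E{r_n(k)⁺ μ_n(k) | c_k = c, S_k = S, [r_m(k)] = ρ}` under `η`, where `μ_n(k)`
is the indicator of a delivery to `n` in period `k`. -/
noncomputable def payoff (η : Policy N T 𝒞 𝒜) (q : Fin N → ℝ) (k : ℕ) (c : 𝒞)
    (S : Finset (Fin N)) (ρ : Fin N → ℝ) : ℝ :=
  ∑ n, max (ρ n) 0 *
    ((m.law η (k + 1)).toOuterMeasure
        (m.stateEvent q k c S ρ ∩ {h | m.DeliveredBy (h (Fin.last k)) n T}) /
      (m.law η (k + 1)).toOuterMeasure (m.stateEvent q k c S ρ)).toReal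

/-- In every period and every state that occurs with positive probability, no policy has a larger
payoff than `η`. -/
def MaximizesPayoff (η : Policy N T 𝒞 𝒜) (q : Fin N → ℝ) : Prop :=
  ∀ k c S ρ, (m.law η (k + 1)).toOuterMeasure (m.stateEvent q k c S ρ) ≠ 0 →
    ∀ η' : Policy N T 𝒞 𝒜, m.payoff η' q k c S ρ ≤ m.payoff η q k c S ρ

/-- In every period `η` transmits, back to back and in an order that meets all their deadlines, the
packets of a deadline-feasible set of arrived clients whose sum of delivery debts is maximal. -/
def IsMaxDebtPolicy (η : Policy N T 𝒞 𝒜) (q : Fin N → ℝ) : Prop :=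
  ∀ k h e, ∀ σ ∈ (η k h e).support, ∃ U l,
    IsMaxDebtSet (m.s e.1) m.τ (m.arr e.2) (m.debt q h) U ∧
    IsOrderingOf U l ∧ OnTime (m.s e.1) m.τ l ∧
    σ = fun t : Fin T => backToBack (m.s e.1) l t

end WirelessSystem

/-! ### A unit-cost machine

Natural-number registers, arrays of naturals and reals, a table of reals and a table of immutable
linked lists. Every operation, memory access, comparison and loop iteration takes one step; in
particular real arithmetic and `cons` do. -/

namespace RAM

inductive NatReg
  | numClients | horizon | period | count | client | row | time
  deriving DecidableEq

inductive NatArr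
  | deadline | service | packet | delivered | order
  deriving DecidableEq

inductive RealArr
  | rate | debt
  deriving DecidableEq

structure Memory where
  reg : NatReg → ℕ
  nat : NatArr → ℕ → ℕ
  real : RealArr → ℕ → ℝ
  /-- the table of the values `M[n,t]` -/
  tab : ℕ → ℕ → ℝ
  /-- the table of the sets `S'[n,t]`, as lists with the client added last in front -/
  sel : ℕ → ℕ → List ℕ

inductive NatExp
  | lit (n : ℕ)
  | reg (x : NatReg)
  | get (a : NatArr) (i : NatExp)
  | add (e f : NatExp)
  | sub (e f : NatExp)

inductive RealExp
  | zero
  | ofNat (e : NatExp)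
  | get (a : RealArr) (i : NatExp)
  | tab (i j : NatExp)
  | add (e f : RealExp)
  | sub (e f : RealExp)
  | mul (e f : RealExp)

inductive ListExp
  | nil
  | sel (i j : NatExp)
  | cons (e : NatExp) (l : ListExp)

inductive BoolExp
  | eq (e f : NatExp)
  | le (e f : NatExp)
  | ltReal (e f : RealExp)
  | and (b c : BoolExp)

inductive Cmd
  | skip
  | setReg (x : NatReg) (e : NatExp)
  | setNat (a : NatArr) (i e : NatExp)
  | setReal (a : RealArr) (i : NatExp) (e : RealExp)
  | setTab (i j : NatExp) (e : RealExp)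
  | setSel (i j : NatExp) (e : ListExp)
  | seq (c d : Cmd)
  | ite (b : BoolExp) (c d : Cmd)
  /-- for `x = lo, …, hi - 1` do `body`, with `lo` and `hi` evaluated once -/
  | loop (x : NatReg) (lo hi : NatExp) (body : Cmd)

def NatExp.eval (m : Memory) : NatExp → ℕ
  | .lit n => n
  | .reg x => m.reg x
  | .get a i => m.nat a (i.eval m)
  | .add e f => e.eval m + f.eval m
  | .sub e f => e.eval m - f.eval m

def NatExp.cost : NatExp → ℕ
  | .lit _ => 1
  | .reg _ => 1
  | .get _ i => i.cost + 1
  | .add e f => e.cost + f.cost + 1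
  | .sub e f => e.cost + f.cost + 1

noncomputable def RealExp.eval (m : Memory) : RealExp → ℝ
  | .zero => 0
  | .ofNat e => (e.eval m : ℝ)
  | .get a i => m.real a (i.eval m)
  | .tab i j => m.tab (i.eval m) (j.eval m)
  | .add e f => e.eval m + f.eval m
  | .sub e f => e.eval m - f.eval m
  | .mul e f => e.eval m * f.eval m

def RealExp.cost : RealExp → ℕ
  | .zero => 1
  | .ofNat e => e.cost + 1
  | .get _ i => i.cost + 1
  | .tab i j => i.cost + j.cost + 1
  | .add e f => e.cost + f.cost + 1
  | .sub e f => e.cost + f.cost + 1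
  | .mul e f => e.cost + f.cost + 1

def ListExp.eval (m : Memory) : ListExp → List ℕ
  | .nil => []
  | .sel i j => m.sel (i.eval m) (j.eval m)
  | .cons e l => e.eval m :: l.eval m

def ListExp.cost : ListExp → ℕ
  | .nil => 1
  | .sel i j => i.cost + j.cost + 1
  | .cons e l => e.cost + l.cost + 1

def BoolExp.eval (m : Memory) : BoolExp → Prop
  | .eq e f => e.eval m = f.eval m
  | .le e f => e.eval m ≤ f.eval m
  | .ltReal e f => e.eval m < f.eval m
  | .and b c => b.eval m ∧ c.eval m

def BoolExp.cost : BoolExp → ℕ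
  | .eq e f => e.cost + f.cost + 1
  | .le e f => e.cost + f.cost + 1
  | .ltReal e f => e.cost + f.cost + 1
  | .and b c => b.cost + c.cost + 1

open Classical in
/-- The final memory and the number of steps of a command. -/
noncomputable def Cmd.run : Cmd → Memory → Memory × ℕ
  | .skip, m => (m, 1)
  | .setReg x e, m => ({ m with reg := Function.update m.reg x (e.eval m) }, e.cost + 1)
  | .setNat a i e, m =>
      ({ m with nat := Function.update m.nat a (Function.update (m.nat a) (i.eval m) (e.eval m)) },
        i.cost + e.cost + 1)
  | .setReal a i e, m =>
      ({ m with
          real := Function.update m.real a (Function.update (m.real a) (i.eval m) (e.eval m)) },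
        i.cost + e.cost + 1)
  | .setTab i j e, m =>
      ({ m with
          tab := Function.update m.tab (i.eval m)
            (Function.update (m.tab (i.eval m)) (j.eval m) (e.eval m)) },
        i.cost + j.cost + e.cost + 1)
  | .setSel i j e, m =>
      ({ m with
          sel := Function.update m.sel (i.eval m)
            (Function.update (m.sel (i.eval m)) (j.eval m) (e.eval m)) },
        i.cost + j.cost + e.cost + 1)
  | .seq c d, m => ((d.run (c.run m).1).1, (c.run m).2 + (d.run (c.run m).1).2)
  | .ite b c d, m =>
      if b.eval m then ((c.run m).1, b.cost + 1 + (c.run m).2)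
      else ((d.run m).1, b.cost + 1 + (d.run m).2)
  | .loop x lo hi body, m =>
      (List.range' (lo.eval m) (hi.eval m - lo.eval m)).foldl
        (fun p v =>
          ((body.run { p.1 with reg := Function.update p.1.reg x v }).1,
            p.2 + 1 + (body.run { p.1 with reg := Function.update p.1.reg x v }).2))
        (m, lo.cost + hi.cost + 1)

/-- Lines 1 to 3: compute the delivery debts. -/
def computeDebts : Cmd :=
  .loop .client (.lit 0) (.reg .numClients)
    (.setReal .debt (.reg .client)
      (.sub (.mul (.get .rate (.reg .client)) (.ofNat (.reg .period)))
        (.ofNat (.get .delivered (.reg .client)))))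

/-- Sort the clients by deadline. -/
def sortClients : Cmd :=
  .seq (.setReg .count (.lit 0))
    (.loop .time (.lit 0) (.add (.reg .horizon) (.lit 1))
      (.loop .client (.lit 0) (.reg .numClients)
        (.ite (.eq (.get .deadline (.reg .client)) (.reg .time))
          (.seq (.setNat .order (.reg .count) (.reg .client))
            (.setReg .count (.add (.reg .count) (.lit 1))))
          .skip)))

/-- `M[0,t] = M[n,0] = 0` and `S'[0,t] = S'[n,0] = ∅`. -/
def initTables : Cmd :=
  .seq
    (.loop .time (.lit 0) (.add (.reg .horizon) (.lit 1))
      (.seq (.setTab (.lit 0) (.reg .time) .zero) (.setSel (.lit 0) (.reg .time) .nil)))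
    (.loop .row (.lit 1) (.add (.reg .numClients) (.lit 1))
      (.seq (.setTab (.reg .row) (.lit 0) .zero) (.setSel (.reg .row) (.lit 0) .nil)))

/-- Compute the entries `[n,t]`, `n = row`, `t = time`, where `client` is the `n`-th client in the
sorted order. The entry `[n - 1, t - s]` is used only if `s ≤ t`. -/
def fillCell : Cmd :=
  .ite (.le (.add (.get .deadline (.reg .client)) (.lit 1)) (.reg .time))
    (.seq
      (.setTab (.reg .row) (.reg .time) (.tab (.reg .row) (.sub (.reg .time) (.lit 1))))
      (.setSel (.reg .row) (.reg .time) (.sel (.reg .row) (.sub (.reg .time) (.lit 1)))))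
    (.ite
      (.and (.eq (.get .packet (.reg .client)) (.lit 1))
        (.and (.le (.get .service (.reg .client)) (.reg .time))
          (.ltReal (.tab (.sub (.reg .row) (.lit 1)) (.reg .time))
            (.add (.get .debt (.reg .client))
              (.tab (.sub (.reg .row) (.lit 1))
                (.sub (.reg .time) (.get .service (.reg .client))))))))
      (.seq
        (.setTab (.reg .row) (.reg .time)
          (.add (.get .debt (.reg .client))
            (.tab (.sub (.reg .row) (.lit 1))
              (.sub (.reg .time) (.get .service (.reg .client))))))
        (.setSel (.reg .row) (.reg .time)
          (.cons (.reg .client)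
            (.sel (.sub (.reg .row) (.lit 1))
              (.sub (.reg .time) (.get .service (.reg .client)))))))
      (.seq
        (.setTab (.reg .row) (.reg .time) (.tab (.sub (.reg .row) (.lit 1)) (.reg .time)))
        (.setSel (.reg .row) (.reg .time) (.sel (.sub (.reg .row) (.lit 1)) (.reg .time)))))

/-- The two nested loops over `n = 1, …, N` and `t = 1, …, horizon`. -/
def fillTables : Cmd :=
  .loop .row (.lit 1) (.add (.reg .numClients) (.lit 1))
    (.seq (.setReg .client (.get .order (.sub (.reg .row) (.lit 1))))
      (.loop .time (.lit 1) (.add (.reg .horizon) (.lit 1)) fillCell))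

/-- The modified knapsack algorithm. -/
def modifiedKnapsack : Cmd :=
  .seq computeDebts (.seq sortClients (.seq initTables fillTables))

/-- An array holding `f n` at position `n`. -/
def arrayOf {N : ℕ} {α : Type*} [Zero α] (f : Fin N → α) (i : ℕ) : α :=
  if h : i < N then f ⟨i, h⟩ else 0

/-- The memory with the input of the algorithm: `N` clients, horizon `H` for the time loop, period
number `k`, deadlines `τ`, service times `s` in the current channel state, the set `S` of arrived
packets, requirements `q`, and numbers `d` of packets delivered so far. -/
def load {N : ℕ} (H : ℕ) (τ s : Fin N → ℕ) (S : Finset (Fin N)) (q : Fin N → ℝ) (k : ℕ)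
    (d : Fin N → ℕ) : Memory where
  reg := fun
    | .numClients => N
    | .horizon => H
    | .period => k
    | _ => 0
  nat := fun
    | .deadline => arrayOf τ
    | .service => arrayOf s
    | .packet => arrayOf fun n => if n ∈ S then 1 else 0
    | .delivered => arrayOf d
    | .order => fun _ => 0
  real := fun
    | .rate => arrayOf q
    | .debt => fun _ => 0
  tab := fun _ _ => 0
  sel := fun _ _ => []

/-- The clients of `S'[N,H]`, in the order in which the algorithm added them. -/
def selected (N H : ℕ) (out : Memory) : List (Fin N) :=
  (out.sel N H).reverse.filterMap fun i => if h : i < N then some ⟨i, h⟩ else none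

end RAM

/-- The Modified Knapsack Policy with horizon `H` for the time loop: at the beginning of each period
run the algorithm and transmit the packets of the selected clients back to back. -/
noncomputable def WirelessSystem.knapsackPolicy {N T : ℕ} {𝒞 : Type*} {𝒜 : Type*}
    (m : WirelessSystem N T 𝒞 𝒜) (H : ℕ) (q : Fin N → ℝ) : Policy N T 𝒞 𝒜 :=
  fun k h e => PMF.pure fun t : Fin T => backToBack (m.s e.1)
    (RAM.selected N H (RAM.modifiedKnapsack.run
      (RAM.load H m.τ (m.s e.1) (m.arr e.2) q k (fun n => m.deliveries h n (k * T)))).1) t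

/-! ### Earliest deadline first -/

/-! Everything rests on an order-free criterion (`deadlineFeasible_iff`): a set can meet its
deadlines iff, for every `d`, the packets due by `d` need at most `d` slots in total. The criterion
suffices for every earliest-deadline-first order, is inherited by subsets, and by counting slots
holds for whatever any plan delivers in a period. So the achievable delivered sets are governed by
the deadline-feasible subsets of the arrivals. Dropping clients with nonpositive debt shows that a
set of maximal debt also maximizes the sum of positive parts, which yields the payoff claim record
by record.

Feasibility optimality is a drift argument along single records. Call a block of `L` periods good if
its states would have allowed serving every client at rate `b * q n`, with a fixed `b > 1`. Over a
good block the squared norm of the positive debts has negative drift, so the norm cannot climb above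
a constant; over a bad block it grows by at most `L * ∑ n, q n` (`exists_debtSeq_le`). A policy
fulfilling `q / α` makes its initial blocks of states good with probability near one
(`StrictlyFeasible.exists_block`). The states evolve independently of the actions and stationarily,
so under any policy every block is equally likely to be good (`law_map_block`). Markov's inequality
then bounds the number of bad blocks, and the debts grow at an arbitrarily small rate.

For the knapsack recursion, the client with the latest deadline can be transmitted last. If it is
served and the cap `t` does not exceed its deadline, the others must finish by `t` minus its service
time (`insert_mem_knapSets_succ`); if the cap exceeds its deadline, the last unit of the cap is
irrelevant (`knapSets_succ_eq_of_lt`). The machine program is compared with the functional recursion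
`knap` through loop invariants that also count steps. -/

theorem OnTime.sum_filter_le {N : ℕ} {s τ : Fin N → ℕ} {l : List (Fin N)} (h : OnTime s τ l)
    (d : ℕ) : ((l.filter (fun n => τ n ≤ d)).map s).sum ≤ d := by
  -- Only the last client matters: if it is due by `d`, its completion time bounds the whole list;
  -- otherwise it is filtered out.
  induction l using List.reverseRecOn with
  | nil => simp
  | append_singleton l n ih =>
    have hl : OnTime s τ l := fun l₁ k l₂ hk => h l₁ k (l₂ ++ [n]) (by simp [hk])
    by_cases hn : τ n ≤ d
    · have h1 := h l n [] rfl
      have h2 : ((l.filter (fun n => τ n ≤ d)).map s).sum ≤ (l.map s).sum :=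
        List.Sublist.sum_le_sum (List.filter_sublist.map s) (by simp)
      simp only [List.filter_append, List.map_append, List.sum_append]
      simp only [hn, decide_true, List.filter_cons_of_pos, List.filter_nil, List.map_cons,
        List.map_nil, List.sum_cons, List.sum_nil]
      omega
    · simpa [List.filter_append, hn] using ih hl

theorem IsOrderingOf.toFinset_eq {N : ℕ} {U : Finset (Fin N)} {l : List (Fin N)}
    (h : IsOrderingOf U l) : l.toFinset = U := by
  ext n; simp [h.2]

theorem DeadlineFeasible.sum_filter_le {N : ℕ} {s τ : Fin N → ℕ} {U : Finset (Fin N)}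
    (h : DeadlineFeasible s τ U) (d : ℕ) : ∑ n ∈ U with τ n ≤ d, s n ≤ d := by
  obtain ⟨l, hl, ht⟩ := h
  have := ht.sum_filter_le d
  rwa [← List.sum_toFinset s (hl.1.filter _), List.toFinset_filter, hl.toFinset_eq,
    Finset.filter_congr (q := fun n => τ n ≤ d) (by simp)] at this

/-- Whatever is sent up to and including `n` is due by `τ n`, so the completion time of `n` is at
most the demand at `d = τ n`. -/
theorem IsEDFOrder.onTime {N : ℕ} {s τ : Fin N → ℕ} {U : Finset (Fin N)} {l : List (Fin N)}
    (hl : IsEDFOrder τ U l) (h : ∀ d, ∑ n ∈ U with τ n ≤ d, s n ≤ d) : OnTime s τ l := by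
  rintro l₁ n l₂ rfl
  refine le_trans ?_ (h (τ n))
  have hnd : (l₁ ++ [n]).Nodup :=
    hl.1.1.sublist ((List.Sublist.refl l₁).append (by simp))
  have h1 : (l₁.map s).sum + s n = ∑ k ∈ (l₁ ++ [n]).toFinset, s k := by
    rw [List.sum_toFinset s hnd]; simp
  rw [h1]
  refine Finset.sum_le_sum_of_subset fun k hk => ?_
  have hp := (List.pairwise_append.1 hl.2).2.2
  rw [List.mem_toFinset, List.mem_append, List.mem_singleton] at hk
  rw [Finset.mem_filter, ← hl.1.2]
  rcases hk with hk | rfl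
  · exact ⟨by simp [hk], hp k hk n (by simp)⟩
  · exact ⟨by simp, le_rfl⟩

theorem exists_isEDFOrder {N : ℕ} (τ : Fin N → ℕ) (U : Finset (Fin N)) :
    ∃ l, IsEDFOrder τ U l := by
  have : Std.Total (fun a b : Fin N => τ a ≤ τ b) := ⟨fun a b => le_total _ _⟩
  have : IsTrans (Fin N) (fun a b : Fin N => τ a ≤ τ b) := ⟨fun a b c => le_trans⟩
  refine ⟨U.toList.insertionSort (fun a b => τ a ≤ τ b), ⟨?_, fun n => ?_⟩, ?_⟩
  · exact (List.perm_insertionSort _ _).nodup_iff.2 U.nodup_toList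
  · rw [(List.perm_insertionSort _ _).mem_iff, Finset.mem_toList]
  · exact List.pairwise_insertionSort _ _

theorem deadlineFeasible_iff {N : ℕ} {s τ : Fin N → ℕ} {U : Finset (Fin N)} :
    DeadlineFeasible s τ U ↔ ∀ d, ∑ n ∈ U with τ n ≤ d, s n ≤ d := by
  refine ⟨fun h => h.sum_filter_le, fun h => ?_⟩
  obtain ⟨l, hl⟩ := exists_isEDFOrder τ U
  exact ⟨l, hl.1, hl.onTime h⟩

theorem DeadlineFeasible.mono {N : ℕ} {s τ : Fin N → ℕ} {U V : Finset (Fin N)}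
    (h : DeadlineFeasible s τ U) (hV : V ⊆ U) : DeadlineFeasible s τ V :=
  deadlineFeasible_iff.2 fun d => le_trans
    (Finset.sum_le_sum_of_subset (Finset.filter_subset_filter _ hV)) (h.sum_filter_le d)

/-- A set of largest total debt also has the largest total positive part of the debts. -/
theorem IsMaxDebtSet.sum_posPart_le {N : ℕ} {s τ : Fin N → ℕ} {S : Finset (Fin N)}
    {r : Fin N → ℝ} {U V : Finset (Fin N)} (hU : IsMaxDebtSet s τ S r U) (hVS : V ⊆ S)
    (hV : DeadlineFeasible s τ V) : ∑ n ∈ V, max (r n) 0 ≤ ∑ n ∈ U, max (r n) 0 := by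
  have h1 : ∑ n ∈ V, max (r n) 0 = ∑ n ∈ V with 0 < r n, r n := by
    rw [Finset.sum_filter]
    refine Finset.sum_congr rfl fun n _ => ?_
    split_ifs with h
    · exact max_eq_left h.le
    · exact max_eq_right (not_lt.1 h)
  rw [h1]
  -- The clients of `V` with positive debt form a feasible competitor of `U`.
  exact (hU.2 _ ((Finset.filter_subset _ _).trans hVS) (hV.mono (Finset.filter_subset _ _))).trans
    (Finset.sum_le_sum fun n _ => le_max_left _ _)

theorem backToBack_eq_some {N : ℕ} (s : Fin N → ℕ) (l₁ : List (Fin N)) (n : Fin N)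
    (l₂ : List (Fin N)) (t : ℕ) (h1 : (l₁.map s).sum ≤ t) (h2 : t < (l₁.map s).sum + s n) :
    backToBack s (l₁ ++ n :: l₂) t = some n := by
  induction l₁ generalizing t with
  | nil => simp_all [backToBack]
  | cons a l ih =>
    simp only [List.map_cons, List.sum_cons] at h1 h2
    simp only [List.cons_append, backToBack]
    rw [if_neg (by omega), ih] <;> omega

/-! ### What can be delivered within one period -/

namespace WirelessSystem

variable {N T : ℕ} {𝒞 : Type*} {𝒜 : Type*} (m : WirelessSystem N T 𝒞 𝒜)

open Classical in
/-- The clients whose packets are delivered in the recorded period. -/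
noncomputable def deliveredSet (x : PeriodRecord N T 𝒞 𝒜) : Finset (Fin N) :=
  Finset.univ.filter fun n => m.DeliveredBy x n T

theorem mem_deliveredSet {x : PeriodRecord N T 𝒞 𝒜} {n : Fin N} :
    n ∈ m.deliveredSet x ↔ m.DeliveredBy x n T := by simp [deliveredSet]

theorem deliveredSet_subset (x : PeriodRecord N T 𝒞 𝒜) : m.deliveredSet x ⊆ m.arr x.1.2 :=
  fun _ hn => (m.mem_deliveredSet.1 hn).1

/-- Delivered clients due by `d` occupy pairwise disjoint sets of slots, each of at least the
service time, among the first `d` slots. Thus no plan can beat the deadline-feasible sets. -/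
theorem deadlineFeasible_deliveredSet (x : PeriodRecord N T 𝒞 𝒜) :
    DeadlineFeasible (m.s x.1.1) m.τ (m.deliveredSet x) := by
  classical
  rw [deadlineFeasible_iff]
  intro d
  set D := (m.deliveredSet x).filter (fun n => m.τ n ≤ d) with hD
  have key : ∀ n ∈ D, m.s x.1.1 n ≤
      ((Finset.univ.filter fun t : Fin T => (t : ℕ) < d).filter
        (fun t => x.2 t = some n)).card := by
    intro n hn
    rw [hD, Finset.mem_filter, mem_deliveredSet] at hn
    obtain ⟨⟨-, a, ha, hx⟩, hd⟩ := hn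
    have hT : a + m.s x.1.1 n ≤ T := ha.trans (min_le_left _ _)
    have hτ : a + m.s x.1.1 n ≤ d := ha.trans ((min_le_right _ _).trans hd)
    let f : Fin (m.s x.1.1 n) → Fin T := fun i => ⟨a + i, by omega⟩
    have hf : Function.Injective f := fun i j hij => by
      have := congrArg Fin.val hij
      simp only [f] at this
      exact Fin.ext (by omega)
    calc m.s x.1.1 n = (Finset.univ.image f).card := by
          rw [Finset.card_image_of_injective _ hf, Finset.card_univ, Fintype.card_fin]
      _ ≤ _ := by
          refine Finset.card_le_card fun t ht => ?_
          obtain ⟨i, -, rfl⟩ := Finset.mem_image.1 ht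
          simp only [Finset.mem_filter, Finset.mem_univ, true_and]
          exact ⟨by simp only [f]; omega, hx _ (by simp [f]) (by simp [f])⟩
  calc ∑ n ∈ D, m.s x.1.1 n
      ≤ ∑ n ∈ D, ((Finset.univ.filter fun t : Fin T => (t : ℕ) < d).filter
        (fun t => x.2 t = some n)).card := Finset.sum_le_sum key
    _ = (D.biUnion fun n => (Finset.univ.filter fun t : Fin T => (t : ℕ) < d).filter
          (fun t => x.2 t = some n)).card := by
        rw [Finset.card_biUnion]
        intro a _ b _ hab
        refine Finset.disjoint_left.2 fun t h1 h2 => hab ?_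
        simpa using ((Finset.mem_filter.1 h1).2.symm.trans (Finset.mem_filter.1 h2).2)
    _ ≤ (Finset.univ.filter fun t : Fin T => (t : ℕ) < d).card :=
        Finset.card_le_card (Finset.biUnion_subset.2 fun _ _ => Finset.filter_subset _ _)
    _ ≤ (Finset.range d).card :=
        Finset.card_le_card_of_injOn (fun t => (t : ℕ)) (fun t ht => by simpa using ht)
          (fun a _ b _ h => Fin.ext h)
    _ = d := Finset.card_range d

/-- An inclusion is enough, since delivered sets are later weighed with nonnegative weights. -/
theorem subset_deliveredSet_of_onTime {e : 𝒞 × 𝒜} {U : Finset (Fin N)} {l : List (Fin N)}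
    (hU : U ⊆ m.arr e.2) (hl : IsOrderingOf U l) (ht : OnTime (m.s e.1) m.τ l) :
    U ⊆ m.deliveredSet (e, fun t : Fin T => backToBack (m.s e.1) l t) := by
  intro n hn
  rw [mem_deliveredSet]
  obtain ⟨l₁, l₂, rfl⟩ := List.append_of_mem ((hl.2 n).2 hn)
  have h1 := ht l₁ n l₂ rfl
  exact ⟨hU hn, (l₁.map (m.s e.1)).sum, le_min (h1.trans (m.τ_le n)) h1,
    fun t h2 h3 => backToBack_eq_some _ _ _ _ _ h2 h3⟩

end WirelessSystem

/-! ### The modified knapsack recursion -/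

/-- A cap `t` leaves the demand inequalities below `t` unchanged and merges those from `t` on into
one bound on the total. -/
theorem deadlineFeasible_min_iff {N : ℕ} {s τ : Fin N → ℕ} {t : ℕ} {U : Finset (Fin N)} :
    DeadlineFeasible s (fun i => min (τ i) t) U ↔
      (∀ d < t, ∑ n ∈ U with τ n ≤ d, s n ≤ d) ∧ ∑ n ∈ U, s n ≤ t := by
  rw [deadlineFeasible_iff]
  constructor
  · intro h
    refine ⟨fun d hd => ?_, ?_⟩
    · convert h d using 3
      simp [not_le.2 hd]
    · convert h t using 2
      simp
  · rintro ⟨h1, h2⟩ d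
    rcases lt_or_ge d t with hd | hd
    · convert h1 d hd using 3
      simp [not_le.2 hd]
    · exact (Finset.sum_le_sum_of_subset (Finset.filter_subset _ _)).trans (h2.trans hd)

section Knapsack

variable {N : ℕ} (s τ : Fin N → ℕ) (S : Finset (Fin N)) (r : Fin N → ℝ) (p : Equiv.Perm (Fin N))

open Classical in
/-- The row of client `i`, from the previous row. -/
noncomputable def knapRow (i : Fin N) (prev : ℕ → ℝ × List (Fin N)) : ℕ → ℝ × List (Fin N)
  | 0 => (0, [])
  | t + 1 =>
    if τ i < t + 1 then knapRow i prev t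
    else if i ∈ S ∧ s i ≤ t + 1 ∧ (prev (t + 1)).1 < r i + (prev (t + 1 - s i)).1 then
      (r i + (prev (t + 1 - s i)).1, i :: (prev (t + 1 - s i)).2)
    else prev (t + 1)

/-- Values and selections computed by the modified knapsack algorithm for clients sorted by `p`,
the client added last in front. -/
noncomputable def knap : ℕ → ℕ → ℝ × List (Fin N)
  | 0 => fun _ => (0, [])
  | n + 1 => if h : n < N then knapRow s τ S r (p ⟨n, h⟩) (knap n) else fun _ => (0, [])

/-- The sets over which `M[n,t]` is the maximum. -/
def knapSets (n t : ℕ) : Set (Finset (Fin N)) :=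
  {U | U ⊆ S ∧ (∀ i ∈ U, (p.symm i : ℕ) < n) ∧ DeadlineFeasible s (fun i => min (τ i) t) U}

/-- The entry `e` is an optimal value together with an optimal set. -/
structure IsOptimalEntry (n t : ℕ) (e : ℝ × List (Fin N)) : Prop where
  nodup : e.2.Nodup
  mem : e.2.toFinset ∈ knapSets s τ S p n t
  sum_eq : ∑ i ∈ e.2.toFinset, r i = e.1
  le : ∀ V ∈ knapSets s τ S p n t, ∑ i ∈ V, r i ≤ e.1
  sorted : e.2.Pairwise fun a b => τ b ≤ τ a

variable {s τ S r p}

theorem empty_mem_knapSets (n t : ℕ) : ∅ ∈ knapSets s τ S p n t :=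
  ⟨Finset.empty_subset _, by simp, deadlineFeasible_min_iff.2 ⟨by simp, by simp⟩⟩

theorem isOptimalEntry_nil {n t : ℕ} (h : ∀ V ∈ knapSets s τ S p n t, V = ∅) :
    IsOptimalEntry s τ S r p n t (0, []) where
  nodup := List.nodup_nil
  mem := by simpa using empty_mem_knapSets n t
  sum_eq := by simp
  le V hV := by simp [h V hV]
  sorted := List.Pairwise.nil

theorem eq_empty_of_mem_knapSets_zero_left {t : ℕ} {V : Finset (Fin N)}
    (hV : V ∈ knapSets s τ S p 0 t) : V = ∅ :=
  Finset.eq_empty_of_forall_notMem fun i hi => absurd (hV.2.1 i hi) (Nat.not_lt_zero _)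

theorem eq_empty_of_mem_knapSets_zero_right (hs : ∀ i, 1 ≤ s i) {n : ℕ} {V : Finset (Fin N)}
    (hV : V ∈ knapSets s τ S p n 0) : V = ∅ := by
  refine Finset.eq_empty_of_forall_notMem fun i hi => ?_
  have h1 := (deadlineFeasible_min_iff.1 hV.2.2).2
  have h2 := Finset.single_le_sum (f := s) (fun _ _ => Nat.zero_le _) hi
  have := hs i
  omega

/-- By sorting, `p ⟨n, h⟩` has the latest deadline among the first `n + 1` clients; caps not below
that deadline have no effect. -/
theorem knapSets_succ_eq_of_lt (hp : Monotone fun i => τ (p i)) {n t : ℕ} (h : n < N)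
    (ht : τ (p ⟨n, h⟩) < t + 1) :
    knapSets s τ S p (n + 1) (t + 1) = knapSets s τ S p (n + 1) t := by
  ext U
  refine and_congr_right fun _ => and_congr_right fun hU => ?_
  rw [deadlineFeasible_iff, deadlineFeasible_iff]
  refine forall_congr' fun d => ?_
  have key : ∀ i ∈ U, (min (τ i) (t + 1) ≤ d ↔ min (τ i) t ≤ d) := fun i hi => ?_
  · rw [Finset.filter_congr key]
  have h1 : τ i ≤ τ (p ⟨n, h⟩) := by
    have := hp (show p.symm i ≤ ⟨n, h⟩ from Nat.lt_succ_iff.1 (hU i hi))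
    simpa using this
  rw [min_eq_left (by omega), min_eq_left (by omega)]

theorem mem_knapSets_succ_of_notMem {n t : ℕ} (h : n < N) {U : Finset (Fin N)}
    (hi : p ⟨n, h⟩ ∉ U) : U ∈ knapSets s τ S p (n + 1) t ↔ U ∈ knapSets s τ S p n t := by
  refine and_congr_right fun _ => and_congr_left fun _ => forall₂_congr fun i hU => ?_
  have : (p.symm i : ℕ) ≠ n := fun h' => hi (by
    rwa [show (⟨n, h⟩ : Fin N) = p.symm i from Fin.ext h'.symm, Equiv.apply_symm_apply])
  omega

/-- The new client is due no earlier than the cap, so it enters only the bound on the total and can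
occupy the last slots before `t`. -/
theorem insert_mem_knapSets_succ {n t : ℕ} (h : n < N) {V : Finset (Fin N)}
    (hi : p ⟨n, h⟩ ∉ V) (ht : t ≤ τ (p ⟨n, h⟩)) (hS : p ⟨n, h⟩ ∈ S) (hs : s (p ⟨n, h⟩) ≤ t) :
    insert (p ⟨n, h⟩) V ∈ knapSets s τ S p (n + 1) t ↔
      V ∈ knapSets s τ S p n (t - s (p ⟨n, h⟩)) := by
  rw [← mem_knapSets_succ_of_notMem h hi]
  refine and_congr (by simp [Finset.insert_subset_iff, hS]) (and_congr ?_ ?_)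
  · simp
  · rw [deadlineFeasible_min_iff, deadlineFeasible_min_iff, Finset.sum_insert hi]
    have key : ∀ d < t, (insert (p ⟨n, h⟩) V).filter (fun i => τ i ≤ d) =
        V.filter (fun i => τ i ≤ d) := fun d hd => by
      rw [Finset.filter_insert, if_neg (by omega)]
    constructor
    · rintro ⟨h1, h2⟩
      refine ⟨fun d hd => ?_, by omega⟩
      have := h1 d (by omega)
      rwa [key d (by omega)] at this
    · rintro ⟨h1, h2⟩
      refine ⟨fun d hd => ?_, by omega⟩
      rw [key d hd]
      rcases lt_or_ge d (t - s (p ⟨n, h⟩)) with hd' | hd'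
      · exact h1 d hd'
      -- Between the reduced cap and `t` the bound on the total already implies the demand
      -- inequality.
      · exact (Finset.sum_le_sum_of_subset (Finset.filter_subset _ _)).trans (h2.trans hd')

theorem mem_and_le_of_mem_knapSets {n t : ℕ} {U : Finset (Fin N)}
    (hU : U ∈ knapSets s τ S p n t) {i : Fin N} (hi : i ∈ U) : i ∈ S ∧ s i ≤ t :=
  ⟨hU.1 hi, (Finset.single_le_sum (f := s) (fun _ _ => Nat.zero_le _) hi).trans
    (deadlineFeasible_min_iff.1 hU.2.2).2⟩

/-- A set avoiding the new client belongs to the previous row; one containing it does so, with the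
reduced cap, after erasing that client. -/
theorem sum_le_of_mem_knapSets_succ {n t : ℕ} (h : n < N) (ht : t ≤ τ (p ⟨n, h⟩))
    {a b : ℝ} (ha : ∀ V ∈ knapSets s τ S p n t, ∑ i ∈ V, r i ≤ a)
    (hb : ∀ V ∈ knapSets s τ S p n (t - s (p ⟨n, h⟩)), ∑ i ∈ V, r i ≤ b)
    {V : Finset (Fin N)} (hV : V ∈ knapSets s τ S p (n + 1) t) :
    ∑ i ∈ V, r i ≤ a ∨
      (p ⟨n, h⟩ ∈ S ∧ s (p ⟨n, h⟩) ≤ t ∧ ∑ i ∈ V, r i ≤ r (p ⟨n, h⟩) + b) := by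
  by_cases hi : p ⟨n, h⟩ ∈ V
  · obtain ⟨hS, hs⟩ := mem_and_le_of_mem_knapSets hV hi
    refine Or.inr ⟨hS, hs, ?_⟩
    rw [← Finset.insert_erase hi, insert_mem_knapSets_succ h (Finset.notMem_erase _ _) ht hS hs]
      at hV
    rw [← Finset.add_sum_erase _ _ hi]
    have := hb _ hV
    linarith
  · exact Or.inl (ha _ ((mem_knapSets_succ_of_notMem h hi).1 hV))

/-- The induction on `t` serves the copying branch, the only one that reads the row being built. -/
theorem isOptimalEntry_knapRow (hs : ∀ i, 1 ≤ s i) (hp : Monotone fun i => τ (p i)) {n : ℕ}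
    (h : n < N) {prev : ℕ → ℝ × List (Fin N)} (hprev : ∀ t, IsOptimalEntry s τ S r p n t (prev t))
    (t : ℕ) : IsOptimalEntry s τ S r p (n + 1) t (knapRow s τ S r (p ⟨n, h⟩) prev t) := by
  have hnot : ∀ t, p ⟨n, h⟩ ∉ (prev t).2.toFinset := fun t hi => by
    simpa using (hprev t).mem.2.1 _ hi
  induction t with
  | zero => exact isOptimalEntry_nil fun V hV => eq_empty_of_mem_knapSets_zero_right hs hV
  | succ t ih =>
    rw [knapRow]
    split_ifs with h1 h2
    · have he := knapSets_succ_eq_of_lt (s := s) (S := S) hp h h1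
      exact ⟨ih.nodup, he ▸ ih.mem, ih.sum_eq, he ▸ ih.le, ih.sorted⟩
    · obtain ⟨hS, hst, hlt⟩ := h2
      have hP := hprev (t + 1 - s (p ⟨n, h⟩))
      have hn := hnot (t + 1 - s (p ⟨n, h⟩))
      refine ⟨?_, ?_, ?_, fun V hV => ?_, ?_⟩
      · exact List.nodup_cons.2 ⟨by simpa using hn, hP.nodup⟩
      · rw [List.toFinset_cons, insert_mem_knapSets_succ h hn (by omega) hS hst]
        exact hP.mem
      · rw [List.toFinset_cons, Finset.sum_insert hn, hP.sum_eq]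
      · rcases sum_le_of_mem_knapSets_succ h (by omega) (hprev (t + 1)).le hP.le hV with h3 | h3
        · exact h3.trans hlt.le
        · exact h3.2.2
      · refine List.pairwise_cons.2 ⟨fun i hi => ?_, hP.sorted⟩
        have := hp (show p.symm i ≤ ⟨n, h⟩ from
          Fin.le_def.2 (hP.mem.2.1 i (List.mem_toFinset.2 hi)).le)
        simpa using this
    · have hP := hprev (t + 1)
      refine ⟨hP.nodup, (mem_knapSets_succ_of_notMem h (hnot _)).2 hP.mem, hP.sum_eq,
        fun V hV => ?_, hP.sorted⟩
      rcases sum_le_of_mem_knapSets_succ h (by omega) hP.le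
        (hprev (t + 1 - s (p ⟨n, h⟩))).le hV with h3 | ⟨h3, h4, h5⟩
      · exact h3
      · refine h5.trans (not_lt.1 fun h6 => h2 ⟨h3, h4, h6⟩)

theorem isOptimalEntry_knap (hs : ∀ i, 1 ≤ s i) (hp : Monotone fun i => τ (p i)) {n : ℕ}
    (h : n ≤ N) (t : ℕ) : IsOptimalEntry s τ S r p n t (knap s τ S r p n t) := by
  induction n generalizing t with
  | zero => exact isOptimalEntry_nil fun V hV => eq_empty_of_mem_knapSets_zero_left hV
  | succ n ih =>
    rw [knap, dif_pos (Nat.lt_of_succ_le h)]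
    exact isOptimalEntry_knapRow hs hp h (ih (Nat.le_of_succ_le h)) t

theorem IsOptimalEntry.isGreatest {n t : ℕ} {e : ℝ × List (Fin N)}
    (h : IsOptimalEntry s τ S r p n t e) :
    IsGreatest {x : ℝ | ∃ U : Finset (Fin N), U ⊆ S ∧ (∀ i ∈ U, (p.symm i : ℕ) < n) ∧
      DeadlineFeasible s (fun i => min (τ i) t) U ∧ x = ∑ i ∈ U, r i} e.1 := by
  refine ⟨⟨_, h.mem.1, h.mem.2.1, h.mem.2.2, h.sum_eq.symm⟩, ?_⟩
  rintro x ⟨U, h1, h2, h3, rfl⟩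
  exact h.le U ⟨h1, h2, h3⟩

-- The strict comparison in `knapRow` only decides which set is kept on a tie; the value is the
-- maximum in either case.
open Classical in
theorem knap_recursion (i : Fin N) (t : ℕ) (ht : 1 ≤ t) :
    (knap s τ S r p (i + 1) t).1 =
      if τ (p i) < t then (knap s τ S r p (i + 1) (t - 1)).1
      else if p i ∈ S ∧ s (p i) ≤ t then
        max (knap s τ S r p i t).1 (r (p i) + (knap s τ S r p i (t - s (p i))).1)
      else (knap s τ S r p i t).1 := by
  obtain ⟨t, rfl⟩ := Nat.exists_eq_add_of_le' ht
  simp only [knap, i.2, dif_pos, Fin.eta, knapRow, Nat.add_sub_cancel]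
  split_ifs with h1 h2 h3 h3
  · rfl
  · exact (max_eq_right h2.2.2.le).symm
  · exact absurd ⟨h2.1, h2.2.1⟩ h3
  · exact (max_eq_left (not_lt.1 fun h4 => h2 ⟨h3.1, h3.2, h4⟩)).symm
  · rfl

theorem IsOptimalEntry.isMaxDebtSet {H : ℕ} (hH : ∀ n, τ n ≤ H) {e : ℝ × List (Fin N)}
    (h : IsOptimalEntry s τ S r p N H e) : IsMaxDebtSet s τ S r e.2.toFinset := by
  have hmin : (fun i => min (τ i) H) = τ := funext fun i => min_eq_left (hH i)
  refine ⟨⟨h.mem.1, ?_⟩, fun V hV hf => ?_⟩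
  · have := h.mem.2.2
    rwa [hmin] at this
  · rw [h.sum_eq]
    exact h.le V ⟨hV, fun i _ => (p.symm i).2, by rwa [hmin]⟩

theorem IsOptimalEntry.isEDFOrder {n t : ℕ} {e : ℝ × List (Fin N)}
    (h : IsOptimalEntry s τ S r p n t e) : IsEDFOrder τ e.2.toFinset e.2.reverse :=
  ⟨⟨List.nodup_reverse.2 h.nodup, by simp⟩, List.pairwise_reverse.2 h.sorted⟩

end Knapsack

/-! ### Correctness and running time of the algorithm -/

namespace RAM

/-- Loop invariants, with a bound for the number of steps. -/
theorem run_loop {x : NatReg} {lo hi : NatExp} {body : Cmd} {M : Memory} (P : ℕ → Memory → Prop)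
    {B a b : ℕ} (ha : lo.eval M = a) (hb : hi.eval M = b) (hab : a ≤ b) (h0 : P a M)
    (step : ∀ v M', a ≤ v → v < b → P v M' →
      P (v + 1) (body.run { M' with reg := Function.update M'.reg x v }).1 ∧
        (body.run { M' with reg := Function.update M'.reg x v }).2 ≤ B) :
    P b ((Cmd.loop x lo hi body).run M).1 ∧
      ((Cmd.loop x lo hi body).run M).2 ≤ lo.cost + hi.cost + 1 + (b - a) * (B + 1) := by
  rw [Cmd.run, ha, hb]
  obtain ⟨n, rfl⟩ := Nat.exists_eq_add_of_le hab
  rw [Nat.add_sub_cancel_left]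
  clear hb hab
  induction n with
  | zero => simpa using h0
  | succ n ih =>
    have ih := ih fun v M' h1 h2 => step v M' h1 (by omega)
    rw [List.range'_1_concat, List.foldl_append, List.foldl_cons, List.foldl_nil]
    obtain ⟨h1, h2⟩ := step _ _ (by omega) (by omega) ih.1
    refine ⟨h1, (Nat.add_le_add (Nat.add_le_add_right ih.2 1) h2).trans (le_of_eq ?_)⟩
    ring

/-- The composition rule of Hoare logic, with step bounds added. -/
theorem run_seq {c d : Cmd} {M : Memory} {P Q : Memory → Prop} {A B : ℕ}
    (hc : P (c.run M).1 ∧ (c.run M).2 ≤ A)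
    (hd : ∀ M', P M' → Q (d.run M').1 ∧ (d.run M').2 ≤ B) :
    Q ((Cmd.seq c d).run M).1 ∧ ((Cmd.seq c d).run M).2 ≤ A + B :=
  ⟨(hd _ hc.1).1, Nat.add_le_add hc.2 (hd _ hc.1).2⟩

theorem arrayOf_val {N : ℕ} {α : Type*} [Zero α] (f : Fin N → α) (i : Fin N) :
    arrayOf f i = f i := by simp [arrayOf]

section Correctness

variable {N : ℕ} (H : ℕ) (τ s : Fin N → ℕ) (S : Finset (Fin N)) (r : Fin N → ℝ)

/-- The memory holds the parameters of the recursion. -/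
structure Loaded (M : Memory) : Prop where
  numClients : M.reg .numClients = N
  horizon : M.reg .horizon = H
  deadline : M.nat .deadline = arrayOf τ
  service : M.nat .service = arrayOf s
  packet : M.nat .packet = arrayOf fun n => if n ∈ S then 1 else 0

/-- The memory holds the parameters of the recursion and the debts. -/
structure Ready (M : Memory) : Prop extends Loaded H τ s S M where
  debt : ∀ i : Fin N, M.real .debt i = r i

variable {H τ s S r}

/-- Frame rule: writes to other registers and arrays do no harm. -/
theorem Loaded.congr {M M' : Memory} (h : Loaded H τ s S M)
    (h1 : M'.reg .numClients = M.reg .numClients) (h2 : M'.reg .horizon = M.reg .horizon)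
    (h3 : M'.nat .deadline = M.nat .deadline) (h4 : M'.nat .service = M.nat .service)
    (h5 : M'.nat .packet = M.nat .packet) : Loaded H τ s S M' :=
  ⟨h1.trans h.1, h2.trans h.2, h3.trans h.3, h4.trans h.4, h5.trans h.5⟩

theorem Ready.congr {M M' : Memory} (h : Ready H τ s S r M)
    (h1 : M'.reg .numClients = M.reg .numClients) (h2 : M'.reg .horizon = M.reg .horizon)
    (h3 : M'.nat .deadline = M.nat .deadline) (h4 : M'.nat .service = M.nat .service)
    (h5 : M'.nat .packet = M.nat .packet) (h6 : M'.real .debt = M.real .debt) :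
    Ready H τ s S r M' :=
  ⟨h.toLoaded.congr h1 h2 h3 h4 h5, fun i => by rw [h6, h.debt]⟩

theorem run_computeDebts {q : Fin N → ℝ} {k : ℕ} {d : Fin N → ℕ}
    (hr : ∀ n, r n = q n * k - d n) :
    Ready H τ s S r (computeDebts.run (load H τ s S q k d)).1 ∧
      (computeDebts.run (load H τ s S q k d)).2 ≤ 3 + N * 13 := by
  have := run_loop (x := .client) (lo := .lit 0) (hi := .reg .numClients)
    (body := .setReal .debt (.reg .client)
      (.sub (.mul (.get .rate (.reg .client)) (.ofNat (.reg .period)))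
        (.ofNat (.get .delivered (.reg .client)))))
    (M := load H τ s S q k d) (B := 12) (a := 0) (b := N)
    (fun v M => Loaded H τ s S M ∧ M.reg .period = k ∧ M.nat .delivered = arrayOf d ∧
      M.real .rate = arrayOf q ∧ ∀ i : Fin N, (i : ℕ) < v → M.real .debt i = r i)
    rfl rfl (Nat.zero_le _) ⟨⟨rfl, rfl, rfl, rfl, rfl⟩, rfl, rfl, rfl, by simp⟩ ?_
  · refine ⟨⟨this.1.1, fun i => this.1.2.2.2.2 i i.2⟩, this.2.trans ?_⟩
    simp [NatExp.cost]
  · rintro v M - hv ⟨hL, hk, hd, hq, hi⟩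
    refine ⟨⟨hL.congr ?_ ?_ ?_ ?_ ?_, ?_, ?_, ?_, fun i hiv => ?_⟩, ?_⟩
    · simp [Cmd.run]
    · simp [Cmd.run]
    · simp [Cmd.run]
    · simp [Cmd.run]
    · simp [Cmd.run]
    · simpa [Cmd.run] using hk
    · simpa [Cmd.run] using hd
    · simpa [Cmd.run] using hq
    · rcases Nat.lt_succ_iff_lt_or_eq.1 hiv with h | rfl
      · simpa [Cmd.run, NatExp.eval, Function.update_apply, h.ne] using hi i h
      · simp [Cmd.run, NatExp.eval, RealExp.eval, hk, hd, hq, arrayOf_val,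
          hr]
    · simp [Cmd.run, RealExp.cost, NatExp.cost]

/-- The clients with deadlines below `t`, as listed by counting sort. -/
def sortedBelow {N : ℕ} (τ : Fin N → ℕ) (t : ℕ) : List ℕ :=
  (List.range t).flatMap fun d => (List.range N).filter fun i => arrayOf τ i = d

/-- The array `order` starts with the list `l`. -/
def Stores (l : List ℕ) (M : Memory) : Prop :=
  M.reg .count = l.length ∧ ∀ (i : ℕ) (h : i < l.length), M.nat .order i = l[i]

/-- Pass `v` of the outer loop appends the clients with deadline exactly `v`. The `H + 1` passes
over `N` clients stay within the order of the table size, with no logarithmic factor. -/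
theorem run_sortClients {M : Memory} (hM : Ready H τ s S r M) :
    (Ready H τ s S r (sortClients.run M).1 ∧ Stores (sortedBelow τ (H + 1)) (sortClients.run M).1) ∧
      (sortClients.run M).2 ≤ 2 + (5 + (H + 1) * (3 + N * 14 + 1)) := by
  refine run_seq (P := fun M => Ready H τ s S r M ∧ Stores [] M)
    (Q := fun M => Ready H τ s S r M ∧ Stores (sortedBelow τ (H + 1)) M)
    ⟨⟨hM.congr ?_ ?_ ?_ ?_ ?_ ?_, ?_⟩, ?_⟩ fun M' hM' => ?_
  iterate 6 simp [Cmd.run]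
  · simp [Cmd.run, Stores, NatExp.eval]
  · simp [Cmd.run, NatExp.cost]
  have hH : (NatExp.add (.reg .horizon) (.lit 1)).eval M' = H + 1 := by
    simp [NatExp.eval, hM'.1.horizon]
  refine run_loop (fun v M => Ready H τ s S r M ∧ Stores (sortedBelow τ v) M) rfl hH
    (Nat.zero_le _) hM' ?_
  rintro v M - hv ⟨hM, hO⟩
  have := run_loop (x := .client) (lo := .lit 0) (hi := .reg .numClients)
    (body := .ite (.eq (.get .deadline (.reg .client)) (.reg .time))
          (.seq (.setNat .order (.reg .count) (.reg .client))
            (.setReg .count (.add (.reg .count) (.lit 1))))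
          .skip)
    (M := { M with reg := Function.update M.reg .time v }) (B := 13) (a := 0) (b := N)
    (fun c M => Ready H τ s S r M ∧ M.reg .time = v ∧ Stores (sortedBelow τ v ++
      (List.range c).filter fun i => arrayOf τ i = v) M) rfl
      (by simp [NatExp.eval, hM.numClients]) (Nat.zero_le _)
      ⟨hM.congr (by simp) (by simp) rfl rfl rfl rfl, by simp, by simpa [Stores] using hO⟩ ?_
  · refine ⟨⟨this.1.1, ?_⟩, this.2⟩
    rw [sortedBelow, List.range_succ, List.flatMap_append]
    simpa [sortedBelow] using this.1.2.2
  · rintro c M - hc ⟨hM, ht, hO⟩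
    rw [List.range_succ, List.filter_append]
    by_cases h : arrayOf τ c = v
    · have hb : BoolExp.eval { M with reg := Function.update M.reg .client c }
          (.eq (.get .deadline (.reg .client)) (.reg .time)) := by
        simp [BoolExp.eval, NatExp.eval, hM.deadline, ht, h]
      rw [Cmd.run, if_pos hb]
      refine ⟨⟨hM.congr ?_ ?_ ?_ ?_ ?_ ?_, ?_, ?_, fun i hi => ?_⟩, ?_⟩
      iterate 6 simp [Cmd.run]
      · simpa [Cmd.run] using ht
      · simp [Cmd.run, NatExp.eval, hO.1, h, add_assoc]
      · simp only [h, List.filter_cons_of_pos, decide_true, List.filter_nil,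
          ← List.append_assoc] at hi ⊢
        rw [List.length_append, List.length_singleton] at hi
        rcases Nat.lt_succ_iff_lt_or_eq.1 hi with h' | rfl
        · rw [List.getElem_append_left h', ← hO.2 i h']
          have h' := h'.ne
          rw [← hO.1] at h'
          simp [Cmd.run, NatExp.eval, h']
        · simp [Cmd.run, NatExp.eval, hO.1]
      · simp [Cmd.run, BoolExp.cost, NatExp.cost]
    · have hb : ¬ BoolExp.eval { M with reg := Function.update M.reg .client c }
          (.eq (.get .deadline (.reg .client)) (.reg .time)) := by
        simp [BoolExp.eval, NatExp.eval, hM.deadline, ht, h]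
      rw [Cmd.run, if_neg hb]
      refine ⟨⟨hM.congr ?_ ?_ ?_ ?_ ?_ ?_, ?_, ?_⟩, ?_⟩
      iterate 6 simp [Cmd.run]
      · simpa [Cmd.run] using ht
      · simpa [Cmd.run, h, Stores] using hO
      · simp [Cmd.run, BoolExp.cost, NatExp.cost]

/-- Each client appears in the pass of its own deadline only, and no deadline exceeds the last pass
`H`. -/
theorem sortedBelow_perm (hH : ∀ n, τ n ≤ H) :
    (sortedBelow τ (H + 1)).Perm (List.range N) := by
  rw [List.perm_ext_iff_of_nodup _ List.nodup_range]
  · intro i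
    simp only [sortedBelow, List.mem_flatMap, List.mem_range, List.mem_filter, decide_eq_true_eq]
    refine ⟨fun ⟨_, _, h, _⟩ => h, fun h => ⟨_, ?_, h, rfl⟩⟩
    rw [arrayOf, dif_pos h]
    exact Nat.lt_succ_iff.2 (hH _)
  · refine List.nodup_flatMap.2 ⟨fun d _ => List.nodup_range.filter _, ?_⟩
    refine List.nodup_range.imp fun hab i h1 h2 => hab ?_
    simp only [List.mem_filter, decide_eq_true_eq] at h1 h2
    exact h1.2.symm.trans h2.2

theorem pairwise_sortedBelow (t : ℕ) :
    (sortedBelow τ t).Pairwise fun i j => arrayOf τ i ≤ arrayOf τ j := by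
  refine List.pairwise_flatMap.2 ⟨fun d _ => ?_, ?_⟩
  · refine List.pairwise_of_forall_mem_list fun i hi j hj => ?_
    simp only [List.mem_filter, decide_eq_true_eq] at hi hj
    rw [hi.2, hj.2]
  · refine List.pairwise_lt_range.imp fun hab i hi j hj => ?_
    simp only [List.mem_filter, decide_eq_true_eq] at hi hj
    rw [hi.2, hj.2]
    exact hab.le

/-- The sorted order is a permutation of the clients. -/
theorem exists_perm_sortedBelow (hH : ∀ n, τ n ≤ H) :
    ∃ p : Equiv.Perm (Fin N), Monotone (fun i => τ (p i)) ∧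
      ∀ M, Stores (sortedBelow τ (H + 1)) M → ∀ i : Fin N, M.nat .order i = p i := by
  have hp := sortedBelow_perm hH
  have hlen : (sortedBelow τ (H + 1)).length = N := by rw [hp.length_eq, List.length_range]
  let f : Fin N → Fin N := fun i => ⟨(sortedBelow τ (H + 1))[i]'(by rw [hlen]; exact i.2),
    List.mem_range.1 (hp.mem_iff.1 (List.getElem_mem _))⟩
  have hf : Function.Injective f := fun i j hij => by
    have h1 := congrArg Fin.val hij
    simp only [f] at h1
    exact Fin.ext ((hp.nodup_iff.2 List.nodup_range).getElem_inj_iff.1 h1)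
  refine ⟨Equiv.ofBijective f (Finite.injective_iff_bijective.1 hf), fun i j hij => ?_,
    fun M hM i => ?_⟩
  · rcases hij.eq_or_lt with rfl | hij
    · exact le_rfl
    · have := List.pairwise_iff_getElem.1 (pairwise_sortedBelow (τ := τ) (H + 1)) i j
        (by rw [hlen]; exact i.2) (by rw [hlen]; exact j.2) hij
      change τ (f i) ≤ τ (f j)
      rwa [← arrayOf_val τ (f i), ← arrayOf_val τ (f j)]
  · rw [hM.2 i (by rw [hlen]; exact i.2)]
    rfl

variable (H τ s S r) (p : Equiv.Perm (Fin N))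

/-- The entries `[n,t]` with `P n t` of both tables are correct. -/
def Filled (P : ℕ → ℕ → Prop) (M : Memory) : Prop :=
  ∀ n ≤ N, ∀ t ≤ H, P n t → M.tab n t = (knap s τ S r p n t).1 ∧
    M.sel n t = (knap s τ S r p n t).2.map Fin.val

variable {H τ s S r p}

theorem knap_zero_right (n : ℕ) : knap s τ S r p n 0 = (0, []) := by
  cases n with
  | zero => rfl
  | succ n => rw [knap]; split_ifs <;> rfl

/-- Border entries do not depend on the order of the clients, hence the quantifier over all `p`. -/
theorem run_initTables {M : Memory} {l : List ℕ} (hM : Ready H τ s S r M ∧ Stores l M) :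
    ((Ready H τ s S r (initTables.run M).1 ∧ Stores l (initTables.run M).1) ∧
        ∀ p, Filled H τ s S r p (fun n t => n = 0 ∨ t = 0) (initTables.run M).1) ∧
      (initTables.run M).2 ≤ 5 + (H + 1) * 9 + (5 + N * 9) := by
  refine run_seq
    (P := fun M => (Ready H τ s S r M ∧ Stores l M) ∧ ∀ t ≤ H, M.tab 0 t = 0 ∧ M.sel 0 t = [])
    (Q := fun M => (Ready H τ s S r M ∧ Stores l M) ∧
      ∀ p, Filled H τ s S r p (fun n t => n = 0 ∨ t = 0) M) ?_ fun M' hM' => ?_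
  · have := run_loop (x := .time) (lo := .lit 0) (hi := .add (.reg .horizon) (.lit 1))
      (body := .seq (.setTab (.lit 0) (.reg .time) .zero) (.setSel (.lit 0) (.reg .time) .nil))
      (M := M) (B := 8) (a := 0) (b := H + 1)
      (fun v M => (Ready H τ s S r M ∧ Stores l M) ∧ ∀ t < v, M.tab 0 t = 0 ∧ M.sel 0 t = [])
      rfl (by simp [NatExp.eval, hM.1.horizon]) (Nat.zero_le _) ⟨hM, by simp⟩ ?_
    · exact ⟨⟨this.1.1, fun t ht => this.1.2 t (Nat.lt_succ_iff.2 ht)⟩, this.2⟩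
    · rintro v M - hv ⟨⟨hM, hO⟩, h⟩
      refine ⟨⟨⟨hM.congr ?_ ?_ ?_ ?_ ?_ ?_, ?_⟩, fun t ht => ?_⟩, ?_⟩
      iterate 6 simp [Cmd.run]
      · simpa [Cmd.run, Stores] using hO
      · rcases Nat.lt_succ_iff_lt_or_eq.1 ht with h' | rfl
        · simpa [Cmd.run, NatExp.eval, Function.update_apply, h'.ne] using h t h'
        · simp [Cmd.run, NatExp.eval, RealExp.eval, ListExp.eval]
      · simp [Cmd.run, NatExp.cost, RealExp.cost, ListExp.cost]
  · have := run_loop (x := .row) (lo := .lit 1) (hi := .add (.reg .numClients) (.lit 1))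
      (body := .seq (.setTab (.reg .row) (.lit 0) .zero) (.setSel (.reg .row) (.lit 0) .nil))
      (M := M') (B := 8) (a := 1) (b := N + 1)
      (fun v M => ((Ready H τ s S r M ∧ Stores l M) ∧ ∀ t ≤ H, M.tab 0 t = 0 ∧ M.sel 0 t = []) ∧
        ∀ n < v, M.tab n 0 = 0 ∧ M.sel n 0 = [])
      rfl (by simp [NatExp.eval, hM'.1.1.numClients]) (by omega)
      ⟨hM', fun n hn => by simpa [Nat.lt_one_iff.1 hn] using hM'.2 0 (Nat.zero_le _)⟩ ?_
    · refine ⟨⟨this.1.1.1, fun p n hn t ht h => ?_⟩, this.2⟩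
      rcases h with rfl | rfl
      · exact this.1.1.2 t ht
      · rw [knap_zero_right]
        exact this.1.2 n (Nat.lt_succ_iff.2 hn)
    · rintro v M hv - ⟨⟨⟨hM, hO⟩, h0⟩, h⟩
      refine ⟨⟨⟨⟨hM.congr ?_ ?_ ?_ ?_ ?_ ?_, ?_⟩, fun t ht => ?_⟩, fun n hn => ?_⟩, ?_⟩
      iterate 6 simp [Cmd.run]
      · simpa [Cmd.run, Stores] using hO
      -- The second loop starts at row 1, so row 0 survives.
      · simpa [Cmd.run, NatExp.eval, Function.update_apply, (Nat.lt_of_succ_le hv).ne] using h0 t ht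
      · rcases Nat.lt_succ_iff_lt_or_eq.1 hn with h' | rfl
        · simpa [Cmd.run, NatExp.eval, Function.update_apply, h'.ne] using h n h'
        · simp [Cmd.run, NatExp.eval, RealExp.eval, ListExp.eval]
      · simp [Cmd.run, NatExp.cost, RealExp.cost, ListExp.cost]

/-- The cell program writes the value and the selection of the recursion into its cell. -/
theorem run_fillCell {M : Memory} (hM : Ready H τ s S r M) {n t : ℕ} (hn : n < N) (ht : t + 1 ≤ H)
    (hs : ∀ i, 1 ≤ s i)
    (hrow : M.reg .row = n + 1) (htime : M.reg .time = t + 1) (hclient : M.reg .client = p ⟨n, hn⟩)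
    (hF : Filled H τ s S r p (fun n' t' => n' < n + 1 ∨ t' = 0 ∨ (n' = n + 1 ∧ t' < t + 1)) M) :
    (fillCell.run M).1 = { M with
        tab := Function.update M.tab (n + 1) (Function.update (M.tab (n + 1)) (t + 1)
          (knap s τ S r p (n + 1) (t + 1)).1)
        sel := Function.update M.sel (n + 1) (Function.update (M.sel (n + 1)) (t + 1)
          ((knap s τ S r p (n + 1) (t + 1)).2.map Fin.val)) } ∧
      (fillCell.run M).2 ≤ 100 := by
  classical
  set i := p ⟨n, hn⟩ with hi
  have hτ : M.nat .deadline i = τ i := by rw [hM.deadline, arrayOf_val]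
  have hsv : M.nat .service i = s i := by rw [hM.service, arrayOf_val]
  have hpk : M.nat .packet i = if i ∈ S then 1 else 0 := by rw [hM.packet, arrayOf_val]
  have hsi := hs i
  have e1 := hF (n + 1) hn t (by omega) (by omega)
  have e2 := hF n hn.le (t + 1) ht (by omega)
  -- If `s i > t + 1`, truncated subtraction points to `[n,0]`; the guard `s i ≤ t + 1` then fails,
  -- so the value is irrelevant.
  have e3 := hF n hn.le (t + 1 - s i) (by omega) (by omega)
  have hk : ∀ t, knap s τ S r p (n + 1) t = knapRow s τ S r i (knap s τ S r p n) t := fun t => by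
    rw [knap, dif_pos hn]
  rw [hk, knapRow, ← hk]
  by_cases h1 : τ i < t + 1
  · rw [if_pos h1, ← e1.1, ← e1.2]
    constructor
    · simp [fillCell, Cmd.run, BoolExp.eval, NatExp.eval, RealExp.eval, ListExp.eval, hrow, htime,
        hclient, hτ, Nat.succ_le_of_lt h1]
    · simp [fillCell, Cmd.run, BoolExp.eval, NatExp.eval, RealExp.eval, ListExp.eval, hrow, htime,
        hclient, hτ, Nat.succ_le_of_lt h1, BoolExp.cost, NatExp.cost, RealExp.cost, ListExp.cost]
  · have h1' : ¬ τ i + 1 ≤ t + 1 := by omega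
    rw [if_neg h1, ← e2.1, ← e3.1]
    by_cases h2 : i ∈ S ∧ s i ≤ t + 1 ∧ M.tab n (t + 1) < r i + M.tab n (t + 1 - s i)
    · rw [if_pos h2, List.map_cons, ← e3.2]
      obtain ⟨h2, h3, h4⟩ := h2
      constructor
      · simp [fillCell, Cmd.run, BoolExp.eval, NatExp.eval, RealExp.eval, ListExp.eval, hrow, htime,
          hclient, hτ, hsv, hpk, hM.debt, h1', h2, h3, h4]
      · simp [fillCell, Cmd.run, BoolExp.eval, NatExp.eval, RealExp.eval, ListExp.eval, hrow, htime,
          hclient, hτ, hsv, hpk, hM.debt, h1', h2, h3, h4, BoolExp.cost, NatExp.cost, RealExp.cost,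
          ListExp.cost]
    · have h2' : ¬ ((if i ∈ S then 1 else 0) = 1 ∧ s i ≤ t + 1 ∧
          M.tab n (t + 1) < r i + M.tab n (t + 1 - s i)) := by
        by_cases hS : i ∈ S <;> simp_all
      rw [if_neg h2, ← e2.1, ← e2.2]
      constructor
      · simp only [fillCell, Cmd.run, BoolExp.eval, NatExp.eval, RealExp.eval, ListExp.eval, hrow,
          htime, hclient, hτ, hsv, hpk, hM.debt, h1', h2', if_false, Nat.add_sub_cancel]
      · simp only [fillCell, Cmd.run, BoolExp.eval, NatExp.eval, RealExp.eval, ListExp.eval, hrow,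
          htime, hclient, hτ, hsv, hpk, hM.debt, h1', h2', if_false, Nat.add_sub_cancel,
          BoolExp.cost, NatExp.cost, RealExp.cost, ListExp.cost]
        norm_num

/-- A cell depends on the previous row and on its left neighbour, so the invariants are "rows below
`v`" outside and "times below `w` in the current row" inside. -/
theorem run_fillTables {M : Memory} (hs : ∀ i, 1 ≤ s i) (hM : Ready H τ s S r M)
    (hO : ∀ i : Fin N, M.nat .order i = p i)
    (hF : Filled H τ s S r p (fun n t => n = 0 ∨ t = 0) M) :
    Filled H τ s S r p (fun _ _ => True) (fillTables.run M).1 ∧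
      (fillTables.run M).2 ≤ 5 + N * (5 + (5 + H * 101) + 1) := by
  have := run_loop (x := .row) (lo := .lit 1) (hi := .add (.reg .numClients) (.lit 1))
    (body := .seq (.setReg .client (.get .order (.sub (.reg .row) (.lit 1))))
      (.loop .time (.lit 1) (.add (.reg .horizon) (.lit 1)) fillCell))
    (M := M) (B := 5 + (5 + H * 101)) (a := 1) (b := N + 1)
    (fun v M => (Ready H τ s S r M ∧ ∀ i : Fin N, M.nat .order i = p i) ∧
      Filled H τ s S r p (fun n t => n < v ∨ t = 0) M)
    rfl (by simp [NatExp.eval, hM.numClients]) (by omega)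
    ⟨⟨hM, hO⟩, fun n hn t ht h => hF n hn t ht (by omega)⟩ ?_
  · refine ⟨fun n hn t ht _ => this.1.2 n hn t ht (Or.inl (Nat.lt_succ_iff.2 hn)), ?_⟩
    refine this.2.trans ?_
    simp [NatExp.cost]
  · rintro v M hv hvN ⟨⟨hM, hO⟩, hF⟩
    obtain ⟨n, rfl⟩ := Nat.exists_eq_add_of_le' hv
    have hn : n < N := by omega
    refine run_seq
      (P := fun M => (Ready H τ s S r M ∧ ∀ i : Fin N, M.nat .order i = p i) ∧
        Filled H τ s S r p (fun n' t => n' < n + 1 ∨ t = 0) M ∧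
        M.reg .row = n + 1 ∧ M.reg .client = p ⟨n, hn⟩)
      (Q := fun M => (Ready H τ s S r M ∧ ∀ i : Fin N, M.nat .order i = p i) ∧
        Filled H τ s S r p (fun n' t => n' < n + 1 + 1 ∨ t = 0) M)
      ⟨⟨⟨hM.congr ?_ ?_ ?_ ?_ ?_ ?_, ?_⟩, ?_, ?_, ?_⟩, ?_⟩ ?_
    iterate 6 simp [Cmd.run]
    · simpa [Cmd.run] using hO
    · simpa [Cmd.run, Filled] using hF
    · simp [Cmd.run]
    · simpa [Cmd.run, NatExp.eval] using hO ⟨n, hn⟩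
    · simp [Cmd.run, NatExp.cost]
    · rintro M ⟨⟨hM, hO⟩, hF, hrow, hclient⟩
      have := run_loop (x := .time) (lo := .lit 1) (hi := .add (.reg .horizon) (.lit 1))
        (body := fillCell) (M := M) (B := 100) (a := 1) (b := H + 1)
        (fun w M => (Ready H τ s S r M ∧ ∀ i : Fin N, M.nat .order i = p i) ∧
          Filled H τ s S r p (fun n' t => n' < n + 1 ∨ t = 0 ∨ (n' = n + 1 ∧ t < w)) M ∧
          M.reg .row = n + 1 ∧ M.reg .client = p ⟨n, hn⟩)
        rfl (by simp [NatExp.eval, hM.horizon]) (by omega)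
        ⟨⟨hM, hO⟩, fun n' h1 t h2 h3 => hF n' h1 t h2 (by omega), hrow, hclient⟩ ?_
      · exact ⟨⟨this.1.1, fun n' h1 t h2 h3 => this.1.2.1 n' h1 t h2 (by omega)⟩, this.2⟩
      · rintro w M hw hwH ⟨⟨hM, hO⟩, hF, hrow, hclient⟩
        obtain ⟨t, rfl⟩ := Nat.exists_eq_add_of_le' hw
        obtain ⟨h1, h2⟩ := run_fillCell (M := { M with reg := Function.update M.reg .time (t + 1) })
          (hM.congr (by simp) (by simp) rfl rfl rfl rfl) hn (by omega) hs (by simpa using hrow)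
          (by simp) (by simpa using hclient) hF
        refine ⟨?_, h2⟩
        rw [h1]
        refine ⟨⟨hM.congr (by simp) (by simp) rfl rfl rfl rfl, hO⟩, ?_, by simpa using hrow,
          by simpa using hclient⟩
        intro n' h3 t' h4 h5
        by_cases h6 : n' = n + 1
        · subst h6
          by_cases h7 : t' = t + 1
          · subst h7
            simp
          · simpa [h7] using hF (n + 1) h3 t' h4 (by omega)
        · simpa [h6] using hF n' h3 t' h4 (by omega)

/-- The algorithm fills the tables with the values of the recursion, in `O(N H)` steps. -/
theorem run_modifiedKnapsack (hs : ∀ i, 1 ≤ s i) (hH : ∀ n, τ n ≤ H) {q : Fin N → ℝ} {k : ℕ}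
    {d : Fin N → ℕ} (hr : ∀ n, r n = q n * k - d n) :
    (∃ p : Equiv.Perm (Fin N), Monotone (fun i => τ (p i)) ∧
      Filled H τ s S r p (fun _ _ => True) (modifiedKnapsack.run (load H τ s S q k d)).1) ∧
      (modifiedKnapsack.run (load H τ s S q k d)).2 ≤ 3 + N * 13 +
        (2 + (5 + (H + 1) * (3 + N * 14 + 1)) + (5 + (H + 1) * 9 + (5 + N * 9) +
          (5 + N * (5 + (5 + H * 101) + 1)))) := by
  obtain ⟨p, hp, hpO⟩ := exists_perm_sortedBelow hH
  have := run_seq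
    (Q := fun M => Filled H τ s S r p (fun _ _ => True) M)
    (run_computeDebts (H := H) (τ := τ) (s := s) (S := S) hr) fun M hM =>
    run_seq
    (P := fun M => Ready H τ s S r M ∧ Stores (sortedBelow τ (H + 1)) M)
    (run_sortClients hM) fun M hM =>
    run_seq
    (P := fun M => (Ready H τ s S r M ∧ Stores (sortedBelow τ (H + 1)) M) ∧
      ∀ p, Filled H τ s S r p (fun n t => n = 0 ∨ t = 0) M)
    (run_initTables hM) fun M hM =>
    run_fillTables hs hM.1.1 (hpO M hM.1.2) (hM.2 p)
  exact ⟨⟨p, hp, this.1⟩, this.2⟩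

theorem selected_eq {M : Memory} (h : Filled H τ s S r p (fun _ _ => True) M) :
    selected N H M = (knap s τ S r p N H).2.reverse := by
  rw [selected, (h N le_rfl H le_rfl trivial).2, ← List.map_reverse, List.filterMap_map]
  convert List.filterMap_some using 2
  simp

end Correctness

end RAM

/-! ### Debts along a sequence of periods -/

section Lyapunov

variable {N : ℕ}

/-- `∑ i < L, 1[n ∈ V i]` -/
def visits (V : ℕ → Finset (Fin N)) (L : ℕ) (n : Fin N) : ℝ :=
  ∑ i ∈ Finset.range L, if n ∈ V i then 1 else 0

theorem visits_nonneg (V : ℕ → Finset (Fin N)) (L : ℕ) (n : Fin N) : 0 ≤ visits V L n :=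
  Finset.sum_nonneg fun i _ => by split_ifs <;> simp

theorem visits_le (V : ℕ → Finset (Fin N)) (L : ℕ) (n : Fin N) : visits V L n ≤ L := by
  calc visits V L n ≤ ∑ i ∈ Finset.range L, (1 : ℝ) :=
        Finset.sum_le_sum fun i _ => by split_ifs <;> simp
    _ = L := by simp

theorem sum_sum_eq_sum_mul_visits (V : ℕ → Finset (Fin N)) (L : ℕ) (w : Fin N → ℝ) :
    ∑ i ∈ Finset.range L, ∑ n ∈ V i, w n = ∑ n, w n * visits V L n := by
  simp only [visits, Finset.mul_sum]
  rw [Finset.sum_comm]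
  exact Finset.sum_congr rfl fun i _ => by simp

/-- Delivery debts before period `k`, if the clients in `D j` are served in period `j`. -/
def debtSeq (q : Fin N → ℝ) (D : ℕ → Finset (Fin N)) (k : ℕ) (n : Fin N) : ℝ :=
  q n * k - visits D k n

theorem debtSeq_add (q : Fin N → ℝ) (D : ℕ → Finset (Fin N)) (k L : ℕ) (n : Fin N) :
    debtSeq q D (k + L) n = debtSeq q D k n + (L * q n - visits (fun i => D (k + i)) L n) := by
  simp only [debtSeq, visits, Finset.sum_range_add, Nat.cast_add]
  ring

/-- The Euclidean norm of the vector of the positive parts of the debts. -/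
noncomputable def debtNorm (q : Fin N → ℝ) (D : ℕ → Finset (Fin N)) (k : ℕ) : ℝ :=
  √(∑ n, max (debtSeq q D k n) 0 ^ 2)

theorem sq_debtNorm (q : Fin N → ℝ) (D : ℕ → Finset (Fin N)) (k : ℕ) :
    debtNorm q D k ^ 2 = ∑ n, max (debtSeq q D k n) 0 ^ 2 :=
  Real.sq_sqrt (Finset.sum_nonneg fun _ _ => sq_nonneg _)

theorem debtNorm_nonneg (q : Fin N → ℝ) (D : ℕ → Finset (Fin N)) (k : ℕ) : 0 ≤ debtNorm q D k :=
  Real.sqrt_nonneg _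

theorem posPart_le_debtNorm (q : Fin N → ℝ) (D : ℕ → Finset (Fin N)) (k : ℕ) (n : Fin N) :
    max (debtSeq q D k n) 0 ≤ debtNorm q D k :=
  Real.le_sqrt_of_sq_le
    (Finset.single_le_sum (f := fun n => max (debtSeq q D k n) 0 ^ 2)
      (fun _ _ => sq_nonneg _) (Finset.mem_univ n))

theorem sum_sq_le_sq_sum {f : Fin N → ℝ} (hf : ∀ n, 0 ≤ f n) : ∑ n, f n ^ 2 ≤ (∑ n, f n) ^ 2 := by
  rw [sq (∑ n, f n), Finset.sum_mul]
  refine Finset.sum_le_sum fun n _ => ?_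
  rw [sq]
  exact mul_le_mul_of_nonneg_left
    (Finset.single_le_sum (fun i _ => hf i) (Finset.mem_univ n)) (hf n)

/-- Lets the drift be expanded as an ordinary square in the positive parts. -/
theorem max_add_sq_le (a b : ℝ) : max (a + b) 0 ^ 2 ≤ (max a 0 + b) ^ 2 := by
  rcases le_total (a + b) 0 with h | h
  · rw [max_eq_right h]
    simpa using sq_nonneg (max a 0 + b)
  · rw [max_eq_left h]
    have := le_max_left a 0
    exact pow_le_pow_left₀ h (by linarith) 2

/-- The worst case, without any service: each positive part gains at most `L * q n`, and the
Euclidean norm of the gains is at most their sum. -/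
theorem debtNorm_add_le {q : Fin N → ℝ} (hq : ∀ n, 0 ≤ q n) (D : ℕ → Finset (Fin N)) (k L : ℕ) :
    debtNorm q D (k + L) ≤ debtNorm q D k + L * ∑ n, q n := by
  have hQ : 0 ≤ ∑ n, q n := Finset.sum_nonneg fun n _ => hq n
  have hZ := debtNorm_nonneg q D k
  have hL : (0 : ℝ) ≤ L := Nat.cast_nonneg L
  refine Real.sqrt_le_iff.2 ⟨by positivity, ?_⟩
  have h1 : ∀ n, max (debtSeq q D (k + L) n) 0 ≤ max (debtSeq q D k n) 0 + L * q n := fun n => by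
    have h2 := visits_nonneg (fun i => D (k + i)) L n
    have h3 := le_max_left (debtSeq q D k n) 0
    have h4 := le_max_right (debtSeq q D k n) 0
    have h5 := mul_nonneg hL (hq n)
    rw [debtSeq_add]
    exact max_le (by linarith) (by linarith)
  calc ∑ n, max (debtSeq q D (k + L) n) 0 ^ 2
      ≤ ∑ n, (max (debtSeq q D k n) 0 + L * q n) ^ 2 :=
        Finset.sum_le_sum fun n _ => pow_le_pow_left₀ (le_max_right _ _) (h1 n) 2
    _ = ∑ n, max (debtSeq q D k n) 0 ^ 2 + 2 * L * (∑ n, max (debtSeq q D k n) 0 * q n)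
          + L ^ 2 * ∑ n, q n ^ 2 := by
        rw [Finset.mul_sum, Finset.mul_sum, ← Finset.sum_add_distrib, ← Finset.sum_add_distrib]
        exact Finset.sum_congr rfl fun n _ => by ring
    _ ≤ debtNorm q D k ^ 2 + 2 * L * (debtNorm q D k * ∑ n, q n) + L ^ 2 * (∑ n, q n) ^ 2 := by
        rw [sq_debtNorm]
        refine add_le_add (add_le_add le_rfl (mul_le_mul_of_nonneg_left ?_ (by positivity)))
          (mul_le_mul_of_nonneg_left (sum_sq_le_sq_sum hq) (by positivity))
        rw [Finset.mul_sum]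
        exact Finset.sum_le_sum fun n _ =>
          mul_le_mul_of_nonneg_right (posPart_le_debtNorm q D k n) (hq n)
    _ = (debtNorm q D k + L * ∑ n, q n) ^ 2 := by ring

/-- In the `L` periods from `k` on, sets of the families `F` could serve every client at a rate of
at least `b` times its requirement. -/
def GoodBlock (F : ℕ → Set (Finset (Fin N))) (q : Fin N → ℝ) (b : ℝ) (k L : ℕ) : Prop :=
  ∃ V : ℕ → Finset (Fin N), (∀ i < L, V i ∈ F (k + i)) ∧ ∀ n, b * L * q n ≤ visits V L n

theorem abs_posPart_sub_le {q : Fin N → ℝ} (hq : ∀ n, 0 ≤ q n) (D : ℕ → Finset (Fin N)) (k : ℕ)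
    {i L : ℕ} (hi : i ≤ L) (n : Fin N) :
    |max (debtSeq q D (k + i) n) 0 - max (debtSeq q D k n) 0| ≤ L * (q n + 1) := by
  refine (abs_max_sub_max_le_abs _ _ _).trans ?_
  rw [debtSeq_add, add_sub_cancel_left, abs_le]
  have h1 := visits_nonneg (fun j => D (k + j)) i n
  have h2 := visits_le (fun j => D (k + j)) i n
  have h3 : (i : ℝ) ≤ L := Nat.cast_le.2 hi
  have h4 := mul_le_mul_of_nonneg_right h3 (hq n)
  have h5 : (0 : ℝ) ≤ i * q n := mul_nonneg (Nat.cast_nonneg i) (hq n)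
  constructor <;> nlinarith

/-- The quadratic drift of the debts over a good block. -/
theorem sq_debtNorm_add_le {q : Fin N → ℝ} (hq : ∀ n, 0 ≤ q n) {D : ℕ → Finset (Fin N)}
    {F : ℕ → Set (Finset (Fin N))} {b : ℝ} {k L : ℕ}
    (hmax : ∀ i < L, ∀ V ∈ F (k + i), ∑ n ∈ V, max (debtSeq q D (k + i) n) 0 ≤
      ∑ n ∈ D (k + i), max (debtSeq q D (k + i) n) 0)
    (hgood : GoodBlock F q b k L) :
    debtNorm q D (k + L) ^ 2 ≤ debtNorm q D k ^ 2 -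
      2 * L * (b - 1) * ∑ n, max (debtSeq q D k n) 0 * q n +
      (4 * ∑ n, (q n + 1) + ∑ n, (q n + 1) ^ 2) * L ^ 2 := by
  obtain ⟨V, hV, hVq⟩ := hgood
  set w : Fin N → ℝ := fun n => max (debtSeq q D k n) 0 with hw
  set d : Fin N → ℝ := visits (fun i => D (k + i)) L with hd
  have hL : (0 : ℝ) ≤ L := Nat.cast_nonneg L
  have hw0 : ∀ n, 0 ≤ w n := fun n => le_max_right _ _
  have hc : ∀ U : Finset (Fin N), ∑ n ∈ U, (L : ℝ) * (q n + 1) ≤ L * ∑ n, (q n + 1) := fun U => by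
    rw [Finset.mul_sum]
    exact Finset.sum_le_univ_sum_of_nonneg fun n => mul_nonneg hL (by linarith [hq n])
  -- Maximality concerns the current debts; freezing them at the start of the block costs `L * (q n
  -- + 1)` per client on each side. Summed over `L` periods and doubled by the cross term, this
  -- yields the coefficient 4.
  have h1 : ∀ i ∈ Finset.range L, ∑ n ∈ V i, w n ≤
      ∑ n ∈ D (k + i), w n + 2 * (L * ∑ n, (q n + 1)) := by
    intro i hi
    rw [Finset.mem_range] at hi
    have h2 : ∀ n, |max (debtSeq q D (k + i) n) 0 - w n| ≤ L * (q n + 1) :=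
      abs_posPart_sub_le hq D k hi.le
    have h3 : ∑ n ∈ V i, w n ≤ ∑ n ∈ V i, (max (debtSeq q D (k + i) n) 0 + L * (q n + 1)) :=
      Finset.sum_le_sum fun n _ => by linarith [(abs_le.1 (h2 n)).1]
    have h4 : ∑ n ∈ D (k + i), max (debtSeq q D (k + i) n) 0 ≤
        ∑ n ∈ D (k + i), (w n + L * (q n + 1)) :=
      Finset.sum_le_sum fun n _ => by linarith [(abs_le.1 (h2 n)).2]
    rw [Finset.sum_add_distrib] at h3 h4
    have h5 := hmax i hi _ (hV i hi)
    have h6 := hc (V i)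
    have h7 := hc (D (k + i))
    linarith
  have h2 := Finset.sum_le_sum h1
  rw [Finset.sum_add_distrib, sum_sum_eq_sum_mul_visits,
    sum_sum_eq_sum_mul_visits (fun i => D (k + i)), Finset.sum_const, Finset.card_range,
    nsmul_eq_mul] at h2
  have h3 : b * L * ∑ n, w n * q n ≤ ∑ n, w n * visits V L n := by
    rw [Finset.mul_sum]
    refine Finset.sum_le_sum fun n _ => ?_
    have := mul_le_mul_of_nonneg_left (hVq n) (hw0 n)
    linarith
  have h4 : ∀ n, (L * q n - d n) ^ 2 ≤ L ^ 2 * (q n + 1) ^ 2 := fun n => by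
    rw [← mul_pow]
    refine sq_le_sq' ?_ ?_
    · linarith [visits_le (fun i => D (k + i)) L n, mul_nonneg hL (hq n)]
    · linarith [visits_nonneg (fun i => D (k + i)) L n]
  calc debtNorm q D (k + L) ^ 2 = ∑ n, max (debtSeq q D k n + (L * q n - d n)) 0 ^ 2 := by
        simp only [sq_debtNorm, debtSeq_add, hd]
    _ ≤ ∑ n, (w n + (L * q n - d n)) ^ 2 := Finset.sum_le_sum fun n _ => max_add_sq_le _ _
    _ = ∑ n, w n ^ 2 + 2 * (L * ∑ n, w n * q n - ∑ n, w n * d n) + ∑ n, (L * q n - d n) ^ 2 := by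
        rw [Finset.mul_sum, ← Finset.sum_sub_distrib, Finset.mul_sum, ← Finset.sum_add_distrib,
          ← Finset.sum_add_distrib]
        exact Finset.sum_congr rfl fun n _ => by ring
    _ ≤ debtNorm q D k ^ 2 + 2 * (L * ∑ n, w n * q n - ∑ n, w n * d n) +
          L ^ 2 * ∑ n, (q n + 1) ^ 2 := by
        rw [sq_debtNorm]
        exact add_le_add le_rfl
          ((Finset.sum_le_sum fun n _ => h4 n).trans_eq (Finset.mul_sum _ _ _).symm)
    _ ≤ _ := by linarith

theorem exists_debtNorm_add_le_max {q : Fin N → ℝ} (hq : ∀ n, 0 < q n) {b : ℝ} (hb : 1 < b)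
    (L : ℕ) : ∃ B : ℝ, 0 ≤ B ∧ ∀ (D : ℕ → Finset (Fin N)) (F : ℕ → Set (Finset (Fin N))) (k : ℕ),
      (∀ i < L, ∀ V ∈ F (k + i), ∑ n ∈ V, max (debtSeq q D (k + i) n) 0 ≤
        ∑ n ∈ D (k + i), max (debtSeq q D (k + i) n) 0) →
      GoodBlock F q b k L → debtNorm q D (k + L) ≤ max (debtNorm q D k) B := by
  have hq0 : ∀ n, 0 ≤ q n := fun n => (hq n).le
  have hL : (0 : ℝ) ≤ L := Nat.cast_nonneg L
  set A : ℝ := 4 * ∑ n, (q n + 1) + ∑ n, (q n + 1) ^ 2 with hA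
  have hA0 : 0 ≤ A := add_nonneg (mul_nonneg (by norm_num)
    (Finset.sum_nonneg fun n _ => by linarith [hq n])) (Finset.sum_nonneg fun n _ => sq_nonneg _)
  -- At this value of the weighted debt the negative drift `2 * L * (b - 1) * R` balances the error
  -- `A * L ^ 2`.
  set R : ℝ := A * L / (2 * (b - 1)) with hR
  have hb' : 0 < 2 * (b - 1) := by linarith
  have hR0 : 0 ≤ R := by positivity
  have hB : 0 ≤ ∑ n, R / q n + L * ∑ n, q n :=
    add_nonneg (Finset.sum_nonneg fun n _ => div_nonneg hR0 (hq0 n))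
      (mul_nonneg hL (Finset.sum_nonneg fun n _ => hq0 n))
  refine ⟨_, hB, fun D F k hmax hgood => ?_⟩
  rcases le_or_gt R (∑ n, max (debtSeq q D k n) 0 * q n) with h | h
  · refine le_max_of_le_left (abs_le_of_sq_le_sq' ?_ (debtNorm_nonneg q D k)).2
    have h1 := sq_debtNorm_add_le hq0 hmax hgood
    rw [hR, div_le_iff₀ hb'] at h
    have h2 := mul_le_mul_of_nonneg_right h hL
    rw [← hA] at h1
    nlinarith
  -- Below the threshold every positive part is at most `R / q n`, and one block adds at most `L * ∑
  -- n, q n`.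
  · refine le_max_of_le_right ((debtNorm_add_le hq0 D k L).trans (add_le_add_left ?_ _))
    have hw : ∀ n, max (debtSeq q D k n) 0 ≤ R / q n := fun n => by
      rw [le_div_iff₀ (hq n)]
      exact (Finset.single_le_sum (f := fun n => max (debtSeq q D k n) 0 * q n)
        (fun i _ => mul_nonneg (le_max_right _ _) (hq0 i)) (Finset.mem_univ n)).trans h.le
    refine le_trans ?_ (Finset.sum_le_sum fun n _ => hw n)
    refine Real.sqrt_le_iff.2 ⟨Finset.sum_nonneg fun n _ => le_max_right _ _, ?_⟩
    exact sum_sq_le_sq_sum fun n => le_max_right _ _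

open Classical in
/-- The debts are bounded in terms of the number of bad blocks. -/
theorem exists_debtSeq_le {q : Fin N → ℝ} (hq : ∀ n, 0 < q n) {b : ℝ} (hb : 1 < b) {L : ℕ}
    (hL : 0 < L) : ∃ B : ℝ, 0 ≤ B ∧
      ∀ (D : ℕ → Finset (Fin N)) (F : ℕ → Set (Finset (Fin N))) (K : ℕ),
      (∀ k < K, ∀ V ∈ F k, ∑ n ∈ V, max (debtSeq q D k n) 0 ≤
        ∑ n ∈ D k, max (debtSeq q D k n) 0) →
      ∀ n, debtSeq q D K n ≤ B +
        L * (∑ n, q n) * ((Finset.range (K / L)).filter fun j => ¬ GoodBlock F q b (j * L) L).card := by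
  obtain ⟨B, hB, h⟩ := exists_debtNorm_add_le_max hq hb L
  have hq0 : ∀ n, 0 ≤ q n := fun n => (hq n).le
  have hQ : 0 ≤ ∑ n, q n := Finset.sum_nonneg fun n _ => hq0 n
  have hL0 : (0 : ℝ) ≤ L := Nat.cast_nonneg L
  -- The extra summand pays for the `K % L` periods after the last full block.
  refine ⟨B + L * ∑ n, q n, by positivity, fun D F K hmax n => ?_⟩
  have key : ∀ J ≤ K / L, debtNorm q D (J * L) ≤ B + L * (∑ n, q n) *
      ((Finset.range J).filter fun j => ¬ GoodBlock F q b (j * L) L).card := by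
    intro J
    induction J with
    | zero => intro _; simpa [debtNorm, debtSeq, visits] using hB
    | succ J ih =>
      intro hJ
      have ih := ih (by omega)
      have hJL : (J + 1) * L ≤ K := (Nat.mul_le_mul_right L hJ).trans (Nat.div_mul_le_self K L)
      rw [Nat.add_mul, one_mul] at hJL ⊢
      rw [Finset.range_add_one, Finset.filter_insert]
      split_ifs with hg
      · exact (h D F (J * L) (fun i hi => hmax _ (by omega)) hg).trans
          (max_le ih (le_add_of_nonneg_right (by positivity)))
      · rw [Finset.card_insert_of_notMem (by simp)]
        have := debtNorm_add_le hq0 D (J * L) L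
        push_cast
        linarith
  have h1 := key _ le_rfl
  have h2 := debtNorm_add_le hq0 D (K / L * L) (K % L)
  rw [Nat.div_add_mod'] at h2
  have h3 := (le_max_left _ _).trans (posPart_le_debtNorm q D K n)
  have h4 : ((K % L : ℕ) : ℝ) * ∑ n, q n ≤ L * ∑ n, q n :=
    mul_le_mul_of_nonneg_right (Nat.cast_le.2 (Nat.mod_lt _ hL).le) hQ
  linarith

end Lyapunov

/-! ### The law of the records -/

theorem PMF.toOuterMeasure_add_compl {α : Type*} (μ : PMF α) (A : Set α) :
    μ.toOuterMeasure A + μ.toOuterMeasure Aᶜ = 1 := by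
  rw [PMF.toOuterMeasure_apply, PMF.toOuterMeasure_apply, ← ENNReal.tsum_add, ← μ.tsum_coe]
  refine tsum_congr fun x => ?_
  by_cases h : x ∈ A <;> simp [h]

theorem PMF.toOuterMeasure_le_one {α : Type*} (μ : PMF α) (A : Set α) :
    μ.toOuterMeasure A ≤ 1 :=
  le_self_add.trans_eq (μ.toOuterMeasure_add_compl A)

theorem PMF.toOuterMeasure_eq_one_sub {α : Type*} (μ : PMF α) (A : Set α) :
    μ.toOuterMeasure A = 1 - μ.toOuterMeasure Aᶜ :=
  ENNReal.eq_sub_of_add_eq (ne_top_of_le_ne_top ENNReal.one_ne_top (μ.toOuterMeasure_le_one _))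
    (μ.toOuterMeasure_add_compl A)

open Classical in
/-- Markov's inequality for the number of events that occur. -/
theorem PMF.toOuterMeasure_card_mul_le {α : Type*} (μ : PMF α) (A : ℕ → Set α) (J : ℕ)
    {p : ENNReal} (hp : ∀ j < J, μ.toOuterMeasure (A j) ≤ p) (a : ENNReal) :
    μ.toOuterMeasure {x | a ≤ ((Finset.range J).filter fun j => x ∈ A j).card} * a ≤ J * p := by
  calc μ.toOuterMeasure {x | a ≤ ((Finset.range J).filter fun j => x ∈ A j).card} * a
      ≤ ∑' x, ∑ j ∈ Finset.range J, (A j).indicator μ x := by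
        rw [PMF.toOuterMeasure_apply, ← ENNReal.tsum_mul_right]
        refine ENNReal.tsum_le_tsum fun x => ?_
        have h1 : ∑ j ∈ Finset.range J, (A j).indicator μ x =
            ((Finset.range J).filter fun j => x ∈ A j).card * μ x := by
          simp only [Set.indicator_apply]
          rw [← Finset.sum_filter, Finset.sum_const, nsmul_eq_mul]
        rw [h1, Set.indicator_apply]
        split_ifs with h
        · rw [mul_comm]
          exact mul_le_mul_left h _
        · simp
    _ = ∑ j ∈ Finset.range J, μ.toOuterMeasure (A j) := by
        simp only [PMF.toOuterMeasure_apply]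
        exact Summable.tsum_finsetSum fun _ _ => ENNReal.summable
    _ ≤ ∑ j ∈ Finset.range J, p :=
        Finset.sum_le_sum fun j hj => hp j (Finset.mem_range.1 hj)
    _ = J * p := by simp

namespace WirelessSystem

variable {N T : ℕ} {𝒞 : Type*} {𝒜 : Type*} (m : WirelessSystem N T 𝒞 𝒜)

/-- The actions of the last period integrate out of anything that depends only on the past and the
current state. -/
theorem law_succ_map {β : Type*} (η : Policy N T 𝒞 𝒜) (k : ℕ)
    (f : (Fin k → PeriodRecord N T 𝒞 𝒜) → 𝒞 × 𝒜 → β) :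
    (m.law η (k + 1)).map (fun h => f (fun j => h j.castSucc) (h (Fin.last k)).1) =
      (m.law η k).bind fun h => (m.stateLaw k h).map (f h) := by
  rw [law, PMF.map_bind]
  congr 1
  funext h
  rw [PMF.map_bind, ← PMF.bind_pure_comp]
  congr 1
  funext e
  rw [PMF.map_comp, Function.comp_apply, ← PMF.map_const (η k h e) (f h e)]
  congr 1
  funext σ
  simp

theorem law_succ_map_init (η : Policy N T 𝒞 𝒜) (k : ℕ) :
    (m.law η (k + 1)).map (fun h j => h j.castSucc) = m.law η k := by
  rw [m.law_succ_map η k fun h _ => h]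
  simp only [PMF.map_const, Function.const_def]
  exact PMF.bind_pure _

theorem law_succ_map_last (η : Policy N T 𝒞 𝒜) (k : ℕ) :
    (m.law η (k + 1)).map (fun h => (h (Fin.last k)).1) = m.init := by
  induction k with
  | zero =>
    rw [m.law_succ_map η 0 fun _ e => e]
    rw [law, PMF.pure_bind, stateLaw]
    exact PMF.map_id _
  | succ k ih =>
    rw [m.law_succ_map η (k + 1) fun _ e => e]
    conv_rhs => rw [← m.stationary, ← ih, PMF.bind_map]
    congr 1
    funext h
    exact PMF.map_id _

/-- Law of the state after a block of states. -/
noncomputable def nextLaw : (L : ℕ) → (Fin L → 𝒞 × 𝒜) → PMF (𝒞 × 𝒜)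
  | 0, _ => m.init
  | L + 1, x => m.trans (x (Fin.last L))

/-- Law of the states of `L` consecutive periods. -/
noncomputable def blockLaw : (L : ℕ) → PMF (Fin L → 𝒞 × 𝒜)
  | 0 => PMF.pure Fin.elim0
  | L + 1 => (blockLaw L).bind fun x =>
      (m.nextLaw L x).map fun e => Fin.snoc (α := fun _ => 𝒞 × 𝒜) x e

/-- Given the whole history, actions included, the next state depends only on the last state; the
policy therefore cannot influence the law of the states. -/
theorem law_map_lastBlock (η : Policy N T 𝒞 𝒜) (k L K : ℕ) (hK : K = k + L) :
    (m.law η K).map (fun h (i : Fin L) => (h ⟨k + i, by omega⟩).1) = m.blockLaw L := by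
  induction L generalizing K with
  | zero =>
    rw [blockLaw, ← PMF.map_const (m.law η K)]
    congr 1
    funext h
    exact Subsingleton.elim _ _
  | succ L ih =>
    subst hK
    have h1 : (fun (h : Fin (k + L + 1) → PeriodRecord N T 𝒞 𝒜) (i : Fin (L + 1)) =>
        (h ⟨k + i, by omega⟩).1) = fun h => (fun (h' : Fin (k + L) → PeriodRecord N T 𝒞 𝒜) e =>
          Fin.snoc (α := fun _ => 𝒞 × 𝒜) (fun i : Fin L => (h' ⟨k + i, by omega⟩).1) e)
          (fun j => h j.castSucc) (h (Fin.last (k + L))).1 := by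
      funext h i
      refine Fin.lastCases ?_ (fun i => ?_) i
      · exact (Fin.snoc_last (α := fun _ => 𝒞 × 𝒜) _ _).symm
      · exact (Fin.snoc_castSucc (α := fun _ => 𝒞 × 𝒜) _
          (fun i : Fin L => (h ⟨k + i, by omega⟩).1) i).symm
    have h2 := m.law_succ_map η (k + L) (fun h' e =>
          Fin.snoc (α := fun _ => 𝒞 × 𝒜) (fun i : Fin L => (h' ⟨k + i, by omega⟩).1) e)
    rw [← h1] at h2
    refine h2.trans ?_
    cases L with
    | zero =>
      -- For a block of length one the preceding state lies outside the block, and stationarity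
      -- supplies the law.
      have h3 := m.law_succ_map_last η k
      rw [m.law_succ_map η k fun _ e => e] at h3
      rw [blockLaw, blockLaw, PMF.pure_bind, nextLaw, ← h3, PMF.map_bind]
      congr 1
      funext h
      rw [PMF.map_comp]
      congr 1
    | succ L =>
      rw [blockLaw, ← ih _ rfl, PMF.bind_map]
      rfl

/-- By stationarity, all blocks of `L` consecutive states have the same law. -/
theorem law_map_block (η : Policy N T 𝒞 𝒜) (k L K : ℕ) (hK : k + L ≤ K) :
    (m.law η K).map (fun h (i : Fin L) => (h ⟨k + i, by omega⟩).1) = m.blockLaw L := by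
  induction K, hK using Nat.le_induction with
  | base => exact m.law_map_lastBlock η k L _ rfl
  | succ K hK ih =>
    rw [← ih, ← m.law_succ_map_init η K, PMF.map_comp]
    rfl

/-- This turns the defining property of a policy into a property of each record of positive
probability, which makes the drift argument pathwise. -/
theorem mem_support_of_mem_support_law {η : Policy N T 𝒞 𝒜} {K : ℕ}
    {h : Fin K → PeriodRecord N T 𝒞 𝒜} (hh : h ∈ (m.law η K).support) {k : ℕ} (hk : k < K) :
    (h ⟨k, hk⟩).2 ∈ (η k (fun j => h ⟨j, by omega⟩) (h ⟨k, hk⟩).1).support := by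
  induction K with
  | zero => omega
  | succ K ih =>
    rw [law, PMF.mem_support_bind_iff] at hh
    obtain ⟨h', hh', hh⟩ := hh
    rw [PMF.mem_support_bind_iff] at hh
    obtain ⟨e, -, hh⟩ := hh
    rw [PMF.mem_support_map_iff] at hh
    obtain ⟨σ, hσ, rfl⟩ := hh
    rcases Nat.lt_succ_iff_lt_or_eq.1 hk with hk' | rfl
    · have := ih hh' hk'
      have e1 : ∀ (j : ℕ) (hj : j < K), (Fin.snoc (α := fun _ => PeriodRecord N T 𝒞 𝒜) h' (e, σ)
          ⟨j, Nat.lt_succ_of_lt hj⟩ : PeriodRecord N T 𝒞 𝒜) = h' ⟨j, hj⟩ := fun j hj =>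
        Fin.snoc_castSucc (α := fun _ => PeriodRecord N T 𝒞 𝒜) (e, σ) h' ⟨j, hj⟩
      rw [e1 k hk']
      have e2 : (fun j : Fin k => (Fin.snoc (α := fun _ => PeriodRecord N T 𝒞 𝒜) h' (e, σ)
          ⟨j, by omega⟩ : PeriodRecord N T 𝒞 𝒜)) = fun j : Fin k => h' ⟨j, by omega⟩ :=
        funext fun j => e1 j (by omega)
      rwa [e2]
    · have e1 : (Fin.snoc (α := fun _ => PeriodRecord N T 𝒞 𝒜) h' (e, σ)
          ⟨k, hk⟩ : PeriodRecord N T 𝒞 𝒜) = (e, σ) :=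
        Fin.snoc_last (α := fun _ => PeriodRecord N T 𝒞 𝒜) (e, σ) h'
      have e2 : (fun j : Fin k => (Fin.snoc (α := fun _ => PeriodRecord N T 𝒞 𝒜) h' (e, σ)
          ⟨j, by omega⟩ : PeriodRecord N T 𝒞 𝒜)) = h' :=
        funext fun j => Fin.snoc_castSucc (α := fun _ => PeriodRecord N T 𝒞 𝒜) (e, σ) h' j
      rw [e1, e2]
      exact hσ

/-! ### Deliveries and debts -/

theorem deliveredBy_iff_of_le {x : PeriodRecord N T 𝒞 𝒜} {n : Fin N} {u : ℕ} (hu : T ≤ u) :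
    m.DeliveredBy x n u ↔ m.DeliveredBy x n T := by
  rw [DeliveredBy, DeliveredBy, min_eq_right ((m.τ_le n).trans hu), min_eq_right (m.τ_le n)]

theorem not_deliveredBy_zero (x : PeriodRecord N T 𝒞 𝒜) (n : Fin N) : ¬ m.DeliveredBy x n 0 := by
  rintro ⟨-, a, ha, -⟩
  have := m.s_pos x.1.1 n
  have := ha.trans (min_le_left _ _)
  omega

/-- The delivered sets of the recorded periods, as a sequence. -/
noncomputable def servedSeq {K : ℕ} (h : Fin K → PeriodRecord N T 𝒞 𝒜) (k : ℕ) : Finset (Fin N) :=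
  if hk : k < K then m.deliveredSet (h ⟨k, hk⟩) else ∅

/-- The sets of clients that can be served in channel and arrival state `e`. -/
def servable (e : 𝒞 × 𝒜) : Set (Finset (Fin N)) :=
  {V | V ⊆ m.arr e.2 ∧ DeadlineFeasible (m.s e.1) m.τ V}

/-- The sets of clients that could be served in the recorded periods. -/
def servableSeq {K : ℕ} (h : Fin K → PeriodRecord N T 𝒞 𝒜) (k : ℕ) : Set (Finset (Fin N)) :=
  {V | ∀ hk : k < K, V ∈ m.servable (h ⟨k, hk⟩).1}

theorem deliveredSet_mem_servable (x : PeriodRecord N T 𝒞 𝒜) :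
    m.deliveredSet x ∈ m.servable x.1 :=
  ⟨m.deliveredSet_subset x, m.deadlineFeasible_deliveredSet x⟩

open Classical in
theorem deliveries_eq_sum {K : ℕ} (h : Fin K → PeriodRecord N T 𝒞 𝒜) (n : Fin N) (t : ℕ) :
    (m.deliveries h n t : ℝ) =
      ∑ j : Fin K, if m.DeliveredBy (h j) n (t - (j : ℕ) * T) then 1 else 0 := by
  simp [deliveries]

theorem visits_servedSeq {K : ℕ} (h : Fin K → PeriodRecord N T 𝒞 𝒜) {k : ℕ} (hk : k ≤ K)
    (n : Fin N) : visits (m.servedSeq h) k n =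
      ∑ j : Fin k, if n ∈ m.deliveredSet (h (j.castLE hk)) then 1 else 0 := by
  rw [visits, Finset.sum_range]
  refine Finset.sum_congr rfl fun j _ => ?_
  rw [servedSeq, dif_pos (j.2.trans_le hk)]
  rfl

theorem le_mul_sub_mul {j k t : ℕ} (hj : j < k) (ht : k * T ≤ t) : T ≤ t - j * T := by
  have h1 : (j + 1) * T ≤ k * T := Nat.mul_le_mul_right T hj
  rw [Nat.add_mul] at h1
  omega

theorem debt_prefix_eq {K : ℕ} (h : Fin K → PeriodRecord N T 𝒞 𝒜) (q : Fin N → ℝ) {k : ℕ}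
    (hk : k ≤ K) : m.debt q (fun j : Fin k => h (j.castLE hk)) = debtSeq q (m.servedSeq h) k := by
  classical
  funext n
  rw [debt, debtSeq, visits_servedSeq m h hk, deliveries_eq_sum]
  congr 1
  refine Finset.sum_congr rfl fun j _ => if_congr ?_ rfl rfl
  rw [mem_deliveredSet, m.deliveredBy_iff_of_le (le_mul_sub_mul j.2 le_rfl)]

/-- Here `x` is the contribution of the unfinished period: discarded in lower bounds, and zero when
`t` is a multiple of `T`. -/
theorem deliveries_eq_visits_add {t : ℕ} (h : Fin (t / T + 1) → PeriodRecord N T 𝒞 𝒜)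
    (n : Fin N) : ∃ x : ℝ, 0 ≤ x ∧ (t = t / T * T → x = 0) ∧
      (m.deliveries h n t : ℝ) = visits (m.servedSeq h) (t / T) n + x := by
  classical
  rw [deliveries_eq_sum, Fin.sum_univ_castSucc, visits_servedSeq m h (Nat.le_succ _)]
  refine ⟨_, ?_, fun ht => ?_, congrArg₂ _ (Finset.sum_congr rfl fun j _ => if_congr ?_ rfl rfl) rfl⟩
  · split_ifs <;> simp
  · rw [if_neg]
    have : t - (Fin.last (t / T) : ℕ) * T = 0 := by rw [Fin.val_last, ← ht, Nat.sub_self]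
    rw [this]
    exact m.not_deliveredBy_zero _ _
  · rw [mem_deliveredSet, Fin.val_castSucc,
      m.deliveredBy_iff_of_le (le_mul_sub_mul j.2 (Nat.div_mul_le_self t T))]
    rfl

variable {m}

/-- The chosen set is optimal for positive parts as well, and all of it is delivered. -/
theorem IsMaxDebtPolicy.sum_posPart_le {η : Policy N T 𝒞 𝒜} {q : Fin N → ℝ}
    (hη : m.IsMaxDebtPolicy η q) {k : ℕ} {h : Fin k → PeriodRecord N T 𝒞 𝒜} {e : 𝒞 × 𝒜}
    {σ : SlotPlan N T} (hσ : σ ∈ (η k h e).support) {V : Finset (Fin N)} (hV : V ∈ m.servable e) :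
    ∑ n ∈ V, max (m.debt q h n) 0 ≤ ∑ n ∈ m.deliveredSet (e, σ), max (m.debt q h n) 0 := by
  obtain ⟨U, l, hU, hl, ht, rfl⟩ := hη k h e σ hσ
  exact (hU.sum_posPart_le hV.1 hV.2).trans (Finset.sum_le_sum_of_subset_of_nonneg
    (m.subset_deliveredSet_of_onTime hU.1.1 hl ht) fun n _ _ => le_max_right _ _)

theorem IsMaxDebtPolicy.sum_debtSeq_le {η : Policy N T 𝒞 𝒜} {q : Fin N → ℝ}
    (hη : m.IsMaxDebtPolicy η q) {K : ℕ} {h : Fin K → PeriodRecord N T 𝒞 𝒜}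
    (hh : h ∈ (m.law η K).support) {k : ℕ} (hk : k < K) {V : Finset (Fin N)}
    (hV : V ∈ m.servableSeq h k) :
    ∑ n ∈ V, max (debtSeq q (m.servedSeq h) k n) 0 ≤
      ∑ n ∈ m.servedSeq h k, max (debtSeq q (m.servedSeq h) k n) 0 := by
  have := hη.sum_posPart_le (m.mem_support_of_mem_support_law hh hk) (hV hk)
  rw [← m.debt_prefix_eq h q hk.le, servedSeq, dif_pos hk]
  exact this

end WirelessSystem

namespace WirelessSystem

variable {N T : ℕ} {𝒞 : Type*} {𝒜 : Type*} (m : WirelessSystem N T 𝒞 𝒜)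

/-! ### The payoff function -/

/-- Exchanging the sums exhibits the payoff as the conditional mean of the delivered weight. -/
theorem payoff_eq [Fintype 𝒞] [Fintype 𝒜] (η : Policy N T 𝒞 𝒜) (q : Fin N → ℝ) (k : ℕ) (c : 𝒞)
    (S : Finset (Fin N)) (ρ : Fin N → ℝ) :
    m.payoff η q k c S ρ =
      (∑ h, (m.stateEvent q k c S ρ).indicator
        (fun h => (m.law η (k + 1) h).toReal *
          ∑ n ∈ m.deliveredSet (h (Fin.last k)), max (ρ n) 0) h) /
      ∑ h, (m.stateEvent q k c S ρ).indicator (fun h => (m.law η (k + 1) h).toReal) h := by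
  classical
  have key : ∀ A : Set (Fin (k + 1) → PeriodRecord N T 𝒞 𝒜),
      ((m.law η (k + 1)).toOuterMeasure A).toReal =
        ∑ h, if h ∈ A then (m.law η (k + 1) h).toReal else 0 := fun A => by
    rw [PMF.toOuterMeasure_apply, tsum_fintype, ENNReal.toReal_sum]
    · refine Finset.sum_congr rfl fun h _ => ?_
      by_cases hA : h ∈ A <;> simp [hA]
    · intro h _
      by_cases hA : h ∈ A <;> simp [hA, PMF.apply_ne_top]
  simp only [payoff, ENNReal.toReal_div, key, Set.indicator_apply, ← mul_div_assoc]
  rw [← Finset.sum_div]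
  congr 1
  simp only [Finset.mul_sum]
  rw [Finset.sum_comm]
  refine Finset.sum_congr rfl fun h _ => ?_
  by_cases hE : h ∈ m.stateEvent q k c S ρ
  · simp only [Set.mem_inter_iff, hE, true_and, Set.mem_ofPred_eq, if_true]
    rw [deliveredSet, Finset.sum_filter]
    refine Finset.sum_congr rfl fun n _ => ?_
    split_ifs <;> ring
  · simp [hE]

variable {m}

theorem IsMaxDebtPolicy.maximizesPayoff [Fintype 𝒞] [Fintype 𝒜] {η : Policy N T 𝒞 𝒜}
    {q : Fin N → ℝ} (hη : m.IsMaxDebtPolicy η q) : m.MaximizesPayoff η q := by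
  classical
  intro k c S ρ hpos η'
  have hmax : ∀ h ∈ m.stateEvent q k c S ρ, h ∈ (m.law η (k + 1)).support →
      ∀ V, V ⊆ S → DeadlineFeasible (m.s c) m.τ V →
      ∑ n ∈ V, max (ρ n) 0 ≤ ∑ n ∈ m.deliveredSet (h (Fin.last k)), max (ρ n) 0 := by
    rintro h ⟨rfl, rfl, rfl⟩ hh V h1 h2
    exact hη.sum_posPart_le (m.mem_support_of_mem_support_law hh (Nat.lt_succ_self k)) ⟨h1, h2⟩
  have hfeas : ∀ h ∈ m.stateEvent q k c S ρ, m.deliveredSet (h (Fin.last k)) ⊆ S ∧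
      DeadlineFeasible (m.s c) m.τ (m.deliveredSet (h (Fin.last k))) := by
    rintro h ⟨rfl, rfl, -⟩
    exact m.deliveredSet_mem_servable _
  obtain ⟨h₀, hs, hE⟩ : ∃ h ∈ (m.law η (k + 1)).support, h ∈ m.stateEvent q k c S ρ := by
    by_contra! hc
    exact hpos ((PMF.toOuterMeasure_apply_eq_zero_iff _ _).2
      (Set.disjoint_left.2 fun h h1 h2 => hc h h1 h2))
  -- All possible records in the event under `η` deliver this same maximal weight, so one of them
  -- serves as reference.
  set W := ∑ n ∈ m.deliveredSet (h₀ (Fin.last k)), max (ρ n) 0 with hW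
  have hW0 : 0 ≤ W := Finset.sum_nonneg fun n _ => le_max_right _ _
  have hupper : m.payoff η' q k c S ρ ≤ W := by
    rw [payoff_eq]
    -- This form also covers a competitor under which the event has probability zero; its payoff is
    -- then 0.
    refine div_le_of_le_mul₀ (Finset.sum_nonneg fun h _ => Set.indicator_nonneg
      (fun _ _ => ENNReal.toReal_nonneg) _) hW0 ?_
    rw [Finset.mul_sum]
    refine Finset.sum_le_sum fun h _ => ?_
    by_cases hh : h ∈ m.stateEvent q k c S ρ
    · rw [Set.indicator_of_mem hh, Set.indicator_of_mem hh, mul_comm]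
      exact mul_le_mul_of_nonneg_right (hmax h₀ hE hs _ (hfeas h hh).1 (hfeas h hh).2)
        ENNReal.toReal_nonneg
    · simp [hh]
  refine hupper.trans ?_
  rw [payoff_eq, le_div_iff₀, Finset.mul_sum]
  · refine Finset.sum_le_sum fun h _ => ?_
    by_cases hh : h ∈ m.stateEvent q k c S ρ
    · rw [Set.indicator_of_mem hh, Set.indicator_of_mem hh, mul_comm]
      by_cases hsup : h ∈ (m.law η (k + 1)).support
      · exact mul_le_mul_of_nonneg_left (hmax h hh hsup _ (hfeas h₀ hE).1 (hfeas h₀ hE).2)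
          ENNReal.toReal_nonneg
      · rw [PMF.mem_support_iff, not_not] at hsup
        simp [hsup]
    · simp [hh]
  · refine lt_of_lt_of_le ?_ (Finset.single_le_sum
      (f := fun h => (m.stateEvent q k c S ρ).indicator (fun h => (m.law η (k + 1) h).toReal) h)
      (fun h _ => Set.indicator_nonneg (fun _ _ => ENNReal.toReal_nonneg) _)
      (Finset.mem_univ h₀))
    simp only [Set.indicator_of_mem hE]
    exact ENNReal.toReal_pos ((PMF.mem_support_iff _ _).1 hs) (PMF.apply_ne_top _ _)

/-! ### Feasibility optimality -/

variable (m)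

/-- Blocks of states in which every client could be served at a rate of at least `b` times its
requirement. -/
def goodStates (q : Fin N → ℝ) (b : ℝ) (L : ℕ) : Set (Fin L → 𝒞 × 𝒜) :=
  {x | ∃ V : ℕ → Finset (Fin N), (∀ i : Fin L, V i ∈ m.servable (x i)) ∧
    ∀ n, b * L * q n ≤ visits V L n}

theorem goodBlock_of_mem_goodStates {q : Fin N → ℝ} {b : ℝ} {k L K : ℕ} (hK : k + L ≤ K)
    {h : Fin K → PeriodRecord N T 𝒞 𝒜}
    (hx : (fun i : Fin L => (h ⟨k + i, by omega⟩).1) ∈ m.goodStates q b L) :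
    GoodBlock (m.servableSeq h) q b k L := by
  obtain ⟨V, h1, h2⟩ := hx
  exact ⟨V, fun i hi _ => h1 ⟨i, hi⟩, h2⟩

theorem law_not_goodBlock_le (η : Policy N T 𝒞 𝒜) (q : Fin N → ℝ) (b : ℝ) {k L K : ℕ}
    (hK : k + L ≤ K) :
    (m.law η K).toOuterMeasure {h | ¬ GoodBlock (m.servableSeq h) q b k L} ≤
      (m.blockLaw L).toOuterMeasure (m.goodStates q b L)ᶜ := by
  rw [← m.law_map_block η k L K hK, PMF.toOuterMeasure_map_apply]
  exact MeasureTheory.measure_mono fun h hh hx => hh (m.goodBlock_of_mem_goodStates hK hx)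

/-- The sets actually delivered witness that the states are good; the success of one policy thus
becomes a statement about the states alone. -/
theorem law_deliveries_le_goodStates (η : Policy N T 𝒞 𝒜) {q q' : Fin N → ℝ} {b ε : ℝ}
    (hε : ∀ n, b * q n ≤ q' n - ε) {t : ℕ} (ht : t = t / T * T) (hL : 0 < t / T) :
    (m.law η (t / T + 1)).toOuterMeasure
      {h | ∀ n, q' n - ε < (m.deliveries h n t : ℝ) / ((t : ℝ) / (T : ℝ))} ≤
      (m.blockLaw (t / T)).toOuterMeasure (m.goodStates q b (t / T)) := by
  rw [← m.law_map_block η 0 (t / T) (t / T + 1) (by omega), PMF.toOuterMeasure_map_apply]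
  refine MeasureTheory.measure_mono fun h hh => ?_
  have hT : (T : ℝ) ≠ 0 := Nat.cast_ne_zero.2 m.T_pos.ne'
  have htT : (t : ℝ) / T = (t / T : ℕ) := by
    rw [div_eq_iff hT]
    exact_mod_cast ht
  refine ⟨m.servedSeq h, fun i => ?_, fun n => ?_⟩
  · rw [servedSeq, dif_pos (by omega)]
    simp only [Nat.zero_add]
    exact m.deliveredSet_mem_servable _
  · have h1 := hh n
    obtain ⟨x, -, hx, h2⟩ := m.deliveries_eq_visits_add h n
    rw [htT, lt_div_iff₀ (Nat.cast_pos.2 hL), h2, hx ht, add_zero] at h1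
    have h3 := mul_le_mul_of_nonneg_right (hε n) (Nat.cast_nonneg (α := ℝ) (t / T))
    linarith

/-- If the requirements are strictly feasible, long blocks of states are good with probability
close to one. -/
theorem StrictlyFeasible.exists_block {q : Fin N → ℝ} (hq : ∀ n, 0 < q n)
    (hf : m.StrictlyFeasible q) : ∃ b : ℝ, 1 < b ∧ ∀ δ : ENNReal, δ ≠ 0 → ∃ L : ℕ, 0 < L ∧
      (m.blockLaw L).toOuterMeasure (m.goodStates q b L)ᶜ ≤ δ := by
  obtain ⟨α, hα0, hα1, η, hη⟩ := hf
  have hα : 1 < 1 / α := by rwa [lt_div_iff₀ hα0, one_mul]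
  obtain ⟨b, hb1, hb2⟩ := exists_between hα
  refine ⟨b, hb1, fun δ hδ => ?_⟩
  obtain ⟨ε, hε, hε0⟩ : ∃ ε : ℝ, (∀ n, b * q n ≤ q n / α - ε) ∧ 0 < ε := by
    have h1 : ∀ᶠ ε in nhdsWithin (0 : ℝ) (Set.Ioi 0), ∀ n, b * q n ≤ q n / α - ε := by
      refine Filter.eventually_all.2 fun n => ?_
      have h2 : 0 < (1 / α - b) * q n := mul_pos (sub_pos.2 hb2) (hq n)
      filter_upwards [Ioo_mem_nhdsGT h2] with ε hε
      have := hε.2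
      rw [div_eq_mul_one_div]
      linarith
    exact (h1.and self_mem_nhdsWithin).exists
  have h1 := (hη ε hε0).eventually
    (lt_mem_nhds (ENNReal.sub_lt_self ENNReal.one_ne_top one_ne_zero hδ))
  obtain ⟨t₀, ht₀⟩ := Filter.eventually_atTop.1 h1
  have hL : (t₀ + 1) * T / T = t₀ + 1 := Nat.mul_div_cancel _ m.T_pos
  -- A positive multiple of `T` leaves no unfinished period, and `t / T` is exact.
  have h2 := ht₀ ((t₀ + 1) * T) (by nlinarith [m.T_pos])
  refine ⟨(t₀ + 1) * T / T, by omega, ?_⟩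
  rw [PMF.toOuterMeasure_eq_one_sub, compl_compl, tsub_le_iff_right, ← tsub_le_iff_left]
  exact h2.le.trans (m.law_deliveries_le_goodStates η hε (by rw [hL]) (by omega))

variable {m}

open Classical in
theorem IsMaxDebtPolicy.fulfilled {η : Policy N T 𝒞 𝒜} {q : Fin N → ℝ}
    (hη : m.IsMaxDebtPolicy η q) (hq : ∀ n, 0 < q n) (hf : m.StrictlyFeasible q) :
    m.Fulfilled η q := by
  intro ε hε
  obtain ⟨b, hb, hblock⟩ := hf.exists_block m hq
  have hQ : 0 ≤ ∑ n, q n := Finset.sum_nonneg fun n _ => (hq n).le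
  -- Tolerated fraction of bad blocks, chosen so that they cost at most `ε / 4` per period; the `+
  -- 1` guards against `N = 0`.
  set θ : ℝ := ε / (4 * (∑ n, q n + 1)) with hθ
  have hθ0 : 0 < θ := by positivity
  have hQθ : (∑ n, q n) * θ ≤ ε / 4 := by
    rw [hθ, mul_div_assoc', div_le_div_iff₀ (by positivity) (by norm_num)]
    nlinarith
  suffices h : Filter.Tendsto (fun t : ℕ => (m.law η (t / T + 1)).toOuterMeasure
      {h | ∀ n, q n - ε < (m.deliveries h n t : ℝ) / ((t : ℝ) / (T : ℝ))}ᶜ)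
      Filter.atTop (nhds 0) by
    have := ENNReal.Tendsto.sub (tendsto_const_nhds (x := (1 : ENNReal))) h
      (Or.inl ENNReal.one_ne_top)
    rw [tsub_zero] at this
    exact this.congr fun t => (PMF.toOuterMeasure_eq_one_sub _ _).symm
  refine ENNReal.tendsto_nhds_zero.2 fun δ hδ => ?_
  -- With this failure probability per block, Markov's inequality makes a fraction `θ` of bad blocks
  -- an event of probability at most `δ`.
  obtain ⟨L, hL, hLδ⟩ := hblock (ENNReal.ofReal θ * δ)
    (mul_ne_zero (ENNReal.ofReal_pos.2 hθ0).ne' hδ.ne')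
  obtain ⟨B, hB, hdebt⟩ := exists_debtSeq_le hq hb hL
  have hT : (0 : ℝ) < T := Nat.cast_pos.2 m.T_pos
  have hlim : Filter.Tendsto (fun t : ℕ => (t : ℝ) / T) Filter.atTop Filter.atTop :=
    tendsto_natCast_atTop_atTop.atTop_div_const hT
  -- The remaining `3 * ε / 4` absorbs the constant `B` and the requirement of the unfinished
  -- period.
  filter_upwards [Filter.eventually_ge_atTop (L * T),
    hlim.eventually_gt_atTop ((∑ n, q n + B) / (3 * ε / 4)),
    hlim.eventually_gt_atTop 0] with t ht1 ht2 ht3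
  have hK : L ≤ t / T := (Nat.le_div_iff_mul_le m.T_pos).2 ht1
  set K := t / T with hKdef
  have hJ : 0 < K / L := Nat.div_pos hK hL
  have hmarkov := (m.law η (K + 1)).toOuterMeasure_card_mul_le
    (fun j => {h | ¬ GoodBlock (m.servableSeq h) q b (j * L) L}) (K / L)
    (fun j hj => (m.law_not_goodBlock_le η q b (by
      have h1 : (j + 1) * L ≤ K / L * L := Nat.mul_le_mul_right L hj
      have h2 := Nat.div_mul_le_self K L
      rw [Nat.add_mul] at h1
      omega)).trans hLδ) (ENNReal.ofReal θ * (K / L : ℕ))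
  have h1 : ENNReal.ofReal θ * (K / L : ℕ) ≠ 0 :=
    mul_ne_zero (ENNReal.ofReal_pos.2 hθ0).ne' (Nat.cast_ne_zero.2 hJ.ne')
  have h2 : ENNReal.ofReal θ * (K / L : ℕ) ≠ ⊤ :=
    ENNReal.mul_ne_top ENNReal.ofReal_ne_top (ENNReal.natCast_ne_top _)
  have hP := (ENNReal.mul_le_mul_iff_left h1 h2).1 (hmarkov.trans_eq
    (show _ = δ * (ENNReal.ofReal θ * (K / L : ℕ)) by ring))
  -- Only records in the support need to be compared, which provides `hsupp`.
  refine (PMF.toOuterMeasure_mono _ ?_).trans hP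
  rintro h ⟨hbad, hsupp⟩
  by_contra hcount
  refine hbad fun n => ?_
  have hcount : (((Finset.range (K / L)).filter fun j =>
      ¬ GoodBlock (m.servableSeq h) q b (j * L) L).card : ENNReal) <
      ENNReal.ofReal θ * (K / L : ℕ) := by
    simpa only [Set.mem_ofPred_eq, not_le] using hcount
  have hcount' : (((Finset.range (K / L)).filter fun j =>
      ¬ GoodBlock (m.servableSeq h) q b (j * L) L).card : ℝ) ≤ θ * (K / L : ℕ) := by
    rw [← ENNReal.ofReal_natCast (K / L), ← ENNReal.ofReal_mul hθ0.le, ← ENNReal.ofReal_natCast]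
      at hcount
    exact (ENNReal.ofReal_lt_ofReal_iff_of_nonneg (Nat.cast_nonneg _)).1 hcount |>.le
  have hd := hdebt (m.servedSeq h) (m.servableSeq h) K
    (fun k hk V hV => hη.sum_debtSeq_le hsupp (hk.trans (Nat.lt_succ_self K)) hV) n
  obtain ⟨x, hx, -, hdel⟩ := m.deliveries_eq_visits_add h n
  rw [lt_div_iff₀ ht3, hdel]
  have hL0 : (0 : ℝ) ≤ L := Nat.cast_nonneg L
  have h1 : L * (∑ n, q n) * (((Finset.range (K / L)).filter fun j =>
      ¬ GoodBlock (m.servableSeq h) q b (j * L) L).card : ℝ) ≤ ε / 4 * K := by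
    calc _ ≤ L * (∑ n, q n) * (θ * (K / L : ℕ)) :=
          mul_le_mul_of_nonneg_left hcount' (by positivity)
      _ = ((∑ n, q n) * θ) * ((K / L * L : ℕ) : ℝ) := by push_cast; ring
      _ ≤ ε / 4 * K := mul_le_mul hQθ (Nat.cast_le.2 (Nat.div_mul_le_self K L))
          (Nat.cast_nonneg _) (by positivity)
  have h2 : (K : ℝ) ≤ t / T := Nat.cast_div_le
  have h3 : (t : ℝ) / T ≤ K + 1 := by
    rw [div_le_iff₀ hT]
    exact_mod_cast (Nat.lt_succ_iff.1 ((Nat.lt_mul_of_div_lt (Nat.lt_succ_self _) m.T_pos).trans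
      (Nat.lt_succ_self _)) : t ≤ _)
  have h4 : q n ≤ ∑ n, q n :=
    Finset.single_le_sum (fun i _ => (hq i).le) (Finset.mem_univ n)
  rw [div_lt_iff₀ (by positivity)] at ht2
  rw [debtSeq] at hd
  have h5 := mul_le_mul_of_nonneg_left h3 (hq n).le
  have h6 := mul_le_mul_of_nonneg_left h2 (show 0 ≤ ε / 4 by positivity)
  linarith

end WirelessSystem

/-! ### The Modified Knapsack Policy and the final assembly -/

theorem RAM.steps_le {N H : ℕ} (hN : 1 ≤ N) (hH : 1 ≤ H) :
    3 + N * 13 + (2 + (5 + (H + 1) * (3 + N * 14 + 1)) + (5 + (H + 1) * 9 + (5 + N * 9) +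
      (5 + N * (5 + (5 + H * 101) + 1)))) ≤ 1000 * (N * H) := by
  have h1 : N ≤ N * H := Nat.le_mul_of_pos_right N hH
  have h2 : H ≤ N * H := Nat.le_mul_of_pos_left H hN
  have h3 : 1 ≤ N * H := hN.trans h1
  ring_nf at *
  omega

theorem WirelessSystem.isMaxDebtPolicy_knapsackPolicy {N T : ℕ} {𝒞 : Type*} {𝒜 : Type*}
    (m : WirelessSystem N T 𝒞 𝒜) {H : ℕ} (hH : ∀ n, m.τ n ≤ H) (q : Fin N → ℝ) :
    m.IsMaxDebtPolicy (m.knapsackPolicy H q) q := by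
  intro k h e σ hσ
  rw [knapsackPolicy, PMF.mem_support_pure_iff] at hσ
  obtain ⟨⟨p, hp, hF⟩, -⟩ := RAM.run_modifiedKnapsack (S := m.arr e.2) (m.s_pos e.1) hH
    (r := m.debt q h) (q := q) (k := k) (d := fun n => m.deliveries h n (k * T)) fun _ => rfl
  have hopt := isOptimalEntry_knap (S := m.arr e.2) (r := m.debt q h) (m.s_pos e.1) hp le_rfl H
  have hmax := hopt.isMaxDebtSet hH
  refine ⟨_, _, hmax, hopt.isEDFOrder.1,
    hopt.isEDFOrder.onTime (deadlineFeasible_iff.1 hmax.1.2), ?_⟩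
  rw [hσ, RAM.selected_eq hF]

theorem mainTheorem3 :
    ∃ C : ℕ, ∀ (N T : ℕ) (𝒞 : Type*) (𝒜 : Type*) [Fintype 𝒞] [Fintype 𝒜]
      (m : WirelessSystem N T 𝒞 𝒜),
      -- earliest-deadline-first reordering of a deadline-feasible set meets all deadlines
      (∀ c U l, DeadlineFeasible (m.s c) m.τ U → IsEDFOrder m.τ U l → OnTime (m.s c) m.τ l) ∧
      -- choosing a maximum-debt set maximizes the payoff function and is feasibility optimal
      (∀ η : (Fin N → ℝ) → Policy N T 𝒞 𝒜, (∀ q, m.IsMaxDebtPolicy (η q) q) →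
        (∀ q, m.MaximizesPayoff (η q) q) ∧ m.FeasibilityOptimal η) ∧
      -- the algorithm, for every horizon bounding the deadlines (such as `T`)
      (∀ H : ℕ, (∀ n, m.τ n ≤ H) →
        (∀ (c : 𝒞) (S : Finset (Fin N)) (q : Fin N → ℝ) (k : ℕ) (d : Fin N → ℕ)
          (r : Fin N → ℝ), (∀ n, r n = q n * k - d n) →
          ∀ (out : RAM.Memory) (steps : ℕ),
          RAM.modifiedKnapsack.run (RAM.load H m.τ (m.s c) S q k d) = (out, steps) →
          -- `M[n,t]` is the maximum debt, and satisfies the recursion, for clients sorted by `p`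
          (∃ p : Equiv.Perm (Fin N), Monotone (fun i => m.τ (p i)) ∧
            (∀ n ≤ N, ∀ t ≤ H, IsGreatest
              {x : ℝ | ∃ U : Finset (Fin N), U ⊆ S ∧ (∀ i ∈ U, (p.symm i : ℕ) < n) ∧
                DeadlineFeasible (m.s c) (fun i => min (m.τ i) t) U ∧ x = ∑ i ∈ U, r i}
              (out.tab n t)) ∧
            (∀ (i : Fin N) (t : ℕ), 1 ≤ t → t ≤ H →
              out.tab (i + 1) t =
                if m.τ (p i) < t then out.tab (i + 1) (t - 1)
                else if p i ∈ S ∧ m.s c (p i) ≤ t then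
                  max (out.tab i t) (r (p i) + out.tab i (t - m.s c (p i)))
                else out.tab i t)) ∧
          -- the selected set has maximum debt and is listed earliest deadline first
          (∃ U : Finset (Fin N), IsMaxDebtSet (m.s c) m.τ S r U ∧
            ∑ i ∈ U, r i = out.tab N H ∧
            IsEDFOrder m.τ U (RAM.selected N H out)) ∧
          -- running time
          (1 ≤ N → 1 ≤ H → steps ≤ C * (N * H))) ∧
        -- the resulting policy
        (∀ q, m.IsMaxDebtPolicy (m.knapsackPolicy H q) q) ∧
        (∀ q, m.MaximizesPayoff (m.knapsackPolicy H q) q) ∧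
        m.FeasibilityOptimal (m.knapsackPolicy H)) := by
  classical
  refine ⟨1000, fun N T 𝒞 𝒜 _ _ m => ⟨fun c U l hU hl => hl.onTime (deadlineFeasible_iff.1 hU),
    fun η hη => ⟨fun q => (hη q).maximizesPayoff, fun q hq hf => (hη q).fulfilled hq hf⟩,
    fun H hH => ⟨?_, m.isMaxDebtPolicy_knapsackPolicy hH,
      fun q => (m.isMaxDebtPolicy_knapsackPolicy hH q).maximizesPayoff,
      fun q hq hf => (m.isMaxDebtPolicy_knapsackPolicy hH q).fulfilled hq hf⟩⟩⟩
  intro c S q k d r hr out steps hrun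
  obtain ⟨⟨p, hp, hF⟩, hsteps⟩ := RAM.run_modifiedKnapsack (S := S) (m.s_pos c) hH hr
  rw [hrun] at hF hsteps
  have hopt : ∀ n ≤ N, ∀ t, IsOptimalEntry (m.s c) m.τ S r p n t (knap (m.s c) m.τ S r p n t) :=
    fun n hn t => isOptimalEntry_knap (m.s_pos c) hp hn t
  refine ⟨⟨p, hp, fun n hn t ht => ?_, fun i t h1 ht => ?_⟩, ⟨_, (hopt N le_rfl H).isMaxDebtSet hH,
    ?_, ?_⟩, fun hN hH1 => hsteps.trans (RAM.steps_le hN hH1)⟩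
  · rw [(hF n hn t ht trivial).1]
    exact (hopt n hn t).isGreatest
  · rw [(hF _ i.2 t ht trivial).1, (hF _ i.2 (t - 1) (by omega) trivial).1,
      (hF _ i.2.le t ht trivial).1, (hF _ i.2.le (t - m.s c (p i)) (by omega) trivial).1,
      knap_recursion i t h1]
  · rw [(hopt N le_rfl H).sum_eq, (hF N le_rfl H le_rfl trivial).1]
  · rw [RAM.selected_eq hF]
    exact (hopt N le_rfl H).isEDFOrder
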